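/- **Setting.** An LCL problem $\Psi$ consists of finite non-empty sets of input and output labels for nodes and for half-edges, a radius $t$, a constant degree bound, and a finite set of permitted labeled balls (rooted labeled graphs of radius at most $t$). Its instances are graphs of bounded degree with an input labeling; an output labeling is *valid* if the labeled radius-$t$ neighbourhood of every node is isomorphic, as a rooted labeled graph, to a permitted ball. An $r(n)$-round LOCAL algorithm $\mathcal A$ is a Turing machine run by every node of an $n$-vertex network (with unique identifiers of $O(\log n)$ bits and numbered ports, $n$ known to the nodes) which communicates with its neighbours in synchronous rounds, returns its output within $r(n)$ rounds, and makes at most $\mathrm{poly}(n)$ steps in total; it has access to a uniform public string $r_{\mathrm{pub}}\in\{0,1\}^{b_{\mathrm{pub}}(n)}$ and, at each node independently, to a uniform private string of $b_{\mathrm{sec}}(n)$ bits, with $b_{\mathrm{pub}},b_{\mathrm{sec}}\le\mathrm{poly}(n)$. In the preset public coins model the graph is fixed first, then $r_{\mathrm{pub}}$ is sampled, then an adversary, who sees $r_{\mathrm{pub}}$, chooses the input labeling, and then the private coins $r_{\mathrm{sec}}$ are tossed and $\mathcal A$ is run. A *bounded* adversary is a non-uniform probabilistic $\mathrm{poly}(n)$-time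 algorithm (a family of probabilistic Boolean circuits of polynomial size, one for each network); an *unbounded* adversary is an arbitrary function of $r_{\mathrm{pub}}$. A function $\epsilon$ is *negligible* if for every polynomial $p$, $\epsilon(n)<1/p(n)$ for all large $n$. **Theorem 3.** Let $\Psi$ be an LCL problem. Assume that there are a negligible function $\epsilon:\mathbb N\to[0,1]$, a function $r:\mathbb N\to\mathbb N$ and an $r(n)$-round LOCAL algorithm $\mathcal A$ such that for every family of $\mathrm{poly}(n)$-time adversaries and all large enough $n$, on every $n$-vertex network, the output of $\mathcal A$ on the input labeling chosen by the adversary is valid with probability at least $1-\epsilon(n)$ (over $r_{\mathrm{pub}}$, $r_{\mathrm{sec}}$ and the coins of the adversary). Assume moreover that there are a family $(G_n)_{n\in\mathbb N}$ of $n$-vertex networks, an infinite set $\mathcal H\subseteq\mathbb N$ and a function $\varphi:\mathbb N\to[0,1]$ with $\varphi(n)\ge 1/p(n)$ for some polynomial $p$ and all large enough $n$, such that for every $n\in\mathcal H$ there is an unbounded adversary against which $\mathcal A$ fails on $G_n$ with probability at least $\varphi(n)$ (over $r_{\mathrm{pub}}$ and $r_{\mathrm{sec}}$). Then there is a public-coin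 infinitely-often polynomially hard-on-average problem in $\mathsf{TFNP}/\mathrm{poly}$. That is, there are a relation $\mathcal S\subseteq\{0,1\}^*\times\{0,1\}^*$, an ensemble $\mathcal D=(\mathcal D_\lambda)_{\lambda\in\mathbb N}$ of distributions on $\{0,1\}^\lambda$, and a length-preserving polynomial-time Turing machine $D$ such that: 1. solutions have polynomially bounded length, membership in $\mathcal S$ is decided by Boolean circuits of polynomial size, and every $x\in\{0,1\}^*$ has some $w$ with $(x,w)\in\mathcal S$; 2. for uniform $\rho\in\{0,1\}^\lambda$, the string $D(\rho)$ is distributed according to $\mathcal D_\lambda$; 3. for every polynomial $T$ there is a negligible $\mu$ such that every non-uniform probabilistic solver $\mathcal B$ of size at most $T(\lambda)$ satisfies, for infinitely many $\lambda$, $$\Pr_{\rho,\ \text{coins of }\mathcal B}\bigl[\mathcal S_x\neq\emptyset\Rightarrow (x,\mathcal B(x,\rho))\in\mathcal S\ \text{ where } x=D(\rho)\bigr]<\mu(\lambda),\qquad \mathcal S_x=\{w:(x,w)\in\mathcal S\}.$$ -/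

import Mathlib

namespace PresetCoins

/-! ### Finite probability, negligible functions -/

/-- Bit strings of length `m`. -/
abbrev Bits (m : ℕ) : Type := Fin m → Bool

open Classical in
/-- Probability of the event `p` when `ω` is uniform in the finite type `Ω`. -/
noncomputable def prob {Ω : Type} [Fintype Ω] (p : Ω → Prop) : ℝ :=
  ((Finset.univ.filter p).card : ℝ) / (Fintype.card Ω : ℝ)

/-- `f` tends to zero faster than every inverse polynomial. -/
def Negligible (f : ℕ → ℝ) : Prop :=
  Asymptotics.SuperpolynomialDecay Filter.atTop (fun n : ℕ => (n : ℝ)) f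

/-! ### Boolean circuits, the model of non-uniform computation -/

/-- A gate of a straight-line Boolean circuit with inputs indexed by `α`; the arguments of a gate
are the positions of earlier gates. -/
inductive Gate (α : Type) : Type
  | input (a : α)
  | const (b : Bool)
  | not (i : ℕ)
  | and (i j : ℕ)
  | or (i j : ℕ)

/-- The value of a gate, where `w` lists the values of the gates before it. A reference to a gate
that is not before it has the value `false`. -/
def Gate.eval {α : Type} (x : α → Bool) (w : List Bool) : Gate α → Bool
  | .input a => x a
  | .const b => b
  | .not i => !(w.getD i false)
  | .and i j => w.getD i false && w.getD j false
  | .or i j => w.getD i false || w.getD j false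

/-- Boolean circuits of fan-in two with inputs indexed by `α` and outputs indexed by `β`. -/
structure Circuit (α β : Type) : Type where
  /-- the gates, in topological order -/
  gates : List (Gate α)
  /-- the gate at which an output is read -/
  out : β → ℕ

/-- The size of a circuit is its number of gates. -/
def Circuit.size {α β : Type} (C : Circuit α β) : ℕ := C.gates.length

/-- The function computed by a circuit. -/
def Circuit.eval {α β : Type} (C : Circuit α β) (x : α → Bool) (b : β) : Bool :=
  (C.gates.foldl (fun w g => w ++ [g.eval x w]) []).getD (C.out b) false

/-- A probabilistic circuit: a circuit with `coins` additional random input bits. -/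
structure RandCircuit (α β : Type) : Type where
  /-- the number of coins tossed -/
  coins : ℕ
  /-- the circuit that reads the input and the coins -/
  circuit : Circuit (α ⊕ Fin coins) β

/-- Output of a probabilistic circuit on input `x` and coins `ω`. -/
def RandCircuit.run {α β : Type} (C : RandCircuit α β) (x : α → Bool) (ω : Bits C.coins) :
    β → Bool :=
  C.circuit.eval (Sum.elim x ω)

/-! ### Networks, labelings, locally checkable labeling problems -/

/-- An `n`-vertex network: a graph of maximal degree at most `Δ`, with unique identifiers of
`O(log n)` bits (at most `c` times the bit length of `n`) and, at every node, a numbering of the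
incident edges (the ports), given as the list of the neighbours. -/
structure Network (Δ c n : ℕ) : Type where
  graph : SimpleGraph (Fin n)
  ports : Fin n → List (Fin n)
  ports_nodup : ∀ v, (ports v).Nodup
  mem_ports : ∀ v u, u ∈ ports v ↔ graph.Adj v u
  degree_le : ∀ v, (ports v).length ≤ Δ
  ident : Fin n → List Bool
  ident_injective : Function.Injective ident
  ident_length : ∀ v, (ident v).length ≤ c * Nat.size n

/-- A labeling of the nodes by `Fin a` and of the half-edges by `Fin b`; the half-edge
`(v, {v, u})` is written as the pair `(v, u)`. The values on non-adjacent pairs play no role. -/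
structure Labeling (n a b : ℕ) : Type where
  node : Fin n → Fin a
  half : Fin n → Fin n → Fin b

/-- A finite graph with a distinguished node and with input and output labels. -/
structure LabeledBall (nodeIn halfIn nodeOut halfOut : ℕ) : Type where
  order : ℕ
  graph : SimpleGraph (Fin order)
  center : Fin order
  inp : Labeling order nodeIn halfIn
  outp : Labeling order nodeOut halfOut

/-- A locally checkable labeling problem. The label sets are finite and non-empty; the labels are
numbered. `constraints` is the finite set of the permitted labeled neighbourhoods, and
`maxDeg` is the constant that bounds the degrees in the instances. -/
structure LCL : Type where
  maxDeg : ℕ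
  nodeIn : ℕ
  halfIn : ℕ
  nodeOut : ℕ
  halfOut : ℕ
  nodeIn_pos : 0 < nodeIn
  halfIn_pos : 0 < halfIn
  nodeOut_pos : 0 < nodeOut
  halfOut_pos : 0 < halfOut
  radius : ℕ
  constraints : Finset (LabeledBall nodeIn halfIn nodeOut halfOut)
  constraints_radius : ∀ B ∈ constraints, ∀ u, B.graph.edist B.center u ≤ radius

/-- The input labelings of the `n`-vertex instances of `Ψ`. -/
abbrev LCL.Input (Ψ : LCL) (n : ℕ) : Type := Labeling n Ψ.nodeIn Ψ.halfIn

/-- The output labelings of the `n`-vertex instances of `Ψ`. -/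
abbrev LCL.Output (Ψ : LCL) (n : ℕ) : Type := Labeling n Ψ.nodeOut Ψ.halfOut

/-- The labeled subgraph induced by the nodes at distance at most `radius` from `v`, with
distinguished node `v`, is isomorphic to `B`. -/
def LCL.Matches (Ψ : LCL) {n : ℕ} (G : SimpleGraph (Fin n)) (x : Ψ.Input n) (y : Ψ.Output n)
    (v : Fin n) (B : LabeledBall Ψ.nodeIn Ψ.halfIn Ψ.nodeOut Ψ.halfOut) : Prop :=
  ∃ e : B.graph ≃g G.induce {u : Fin n | G.edist v u ≤ Ψ.radius},
    (e B.center : Fin n) = v ∧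
    (∀ w, B.inp.node w = x.node (e w) ∧ B.outp.node w = y.node (e w)) ∧
    (∀ w w', B.graph.Adj w w' →
      B.inp.half w w' = x.half (e w) (e w') ∧ B.outp.half w w' = y.half (e w) (e w'))

/-- `y` is a valid output labeling for the graph `G` with input labeling `x`. -/
def LCL.IsSolution (Ψ : LCL) {n : ℕ} (G : SimpleGraph (Fin n)) (x : Ψ.Input n)
    (y : Ψ.Output n) : Prop :=
  ∀ v, ∃ B ∈ Ψ.constraints, Ψ.Matches G x y v B

/-- The binary code of a label, with a fixed number of bits, least significant bit first. -/
def encodeLabel {a : ℕ} (l : Fin a) : Bits (Nat.size a) := fun i => (l : ℕ).testBit i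

/-- The label with a given binary code (label `0` if there is none). -/
def decodeLabel {a : ℕ} (ha : 0 < a) (b : Bits (Nat.size a)) : Fin a :=
  if h : Nat.ofBits b < a then ⟨Nat.ofBits b, h⟩ else ⟨0, ha⟩

/-! ### LOCAL algorithms with polynomial-time nodes -/

/-- Tape symbols. -/
inductive Sym : Type
  | blank
  | sep
  | bit (b : Bool)
  deriving DecidableEq

instance : Inhabited Sym := ⟨Sym.blank⟩

/-- The tapes of a node: input, private coins, public coins, work, output, and for each port the
outgoing and the incoming message. -/
inductive TapeId (Δ : ℕ) : Type
  | input
  | priv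
  | pub
  | work
  | out
  | send (p : Fin Δ)
  | recv (p : Fin Δ)

/-- The Turing machine that all the nodes run. It computes from `start` in the beginning, and from
`recv` when the messages of a round have arrived; in state `send` it has finished its local
computation and its messages go out; in state `halt` it has returned its output. -/
structure NodeMachine (Δ : ℕ) : Type where
  states : ℕ
  start : Fin states
  recv : Fin states
  send : Fin states
  halt : Fin states
  trans : Fin states → (TapeId Δ → Sym) →
    Fin states × (TapeId Δ → Sym × Option Turing.Dir)

/-- Configuration of a node, with the number of steps that it has made so far. -/
structure NodeConfig {Δ : ℕ} (M : NodeMachine Δ) : Type where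
  state : Fin M.states
  tape : TapeId Δ → Turing.Tape Sym
  steps : ℕ

/-- Write a symbol, then move the head (or leave it in place). -/
def act (T : Turing.Tape Sym) (a : Sym × Option Turing.Dir) : Turing.Tape Sym :=
  match a.2 with
  | none => T.write a.1
  | some d => (T.write a.1).move d

/-- One step of a node; nothing happens in the states `send` and `halt`. -/
def NodeMachine.step {Δ : ℕ} (M : NodeMachine Δ) (s : NodeConfig M) : NodeConfig M :=
  if s.state = M.send ∨ s.state = M.halt then s
  else
    let q := M.trans s.state (fun t => (s.tape t).head)
    { state := q.1, tape := fun t => act (s.tape t) (q.2 t), steps := s.steps + 1 }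

/-- The blank tape. -/
def blankTape : Turing.Tape Sym := Turing.Tape.mk₁ []

/-- The tape that holds `l`, with the head at its left end. -/
def bitTape (l : List Bool) : Turing.Tape Sym := Turing.Tape.mk₁ (l.map Sym.bit)

/-- What the input tape of node `v` holds: the number of nodes in unary, the identifier, the input
label of the node, and the input labels of its half-edges in the order of the ports. -/
def inputWord {Δ c n a b : ℕ} (N : Network Δ c n) (x : Labeling n a b) (v : Fin n) : List Sym :=
  List.replicate n (Sym.bit true) ++
    Sym.sep :: (N.ident v).map Sym.bit ++
    Sym.sep :: (List.ofFn (encodeLabel (x.node v))).map Sym.bit ++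
    (N.ports v).flatMap
      (fun u => Sym.sep :: (List.ofFn (encodeLabel (x.half v u))).map Sym.bit)

/-- The configuration in which node `v` begins. -/
def NodeMachine.init {Δ c n a b k m : ℕ} (M : NodeMachine Δ) (N : Network Δ c n)
    (x : Labeling n a b) (rpub : Bits k) (rsec : Fin n → Bits m) (v : Fin n) : NodeConfig M where
  state := M.start
  tape
    | .input => Turing.Tape.mk₁ (inputWord N x v)
    | .priv => bitTape (List.ofFn (rsec v))
    | .pub => bitTape (List.ofFn rpub)
    | _ => blankTape
  steps := 0

/-- What arrives at `v` from its neighbour `u`: if `u` is sending, the content of its outgoing tape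
for the edge to `v`, from the head rightwards. -/
def NodeMachine.message {Δ c n : ℕ} (M : NodeMachine Δ) (N : Network Δ c n)
    (s : Fin n → NodeConfig M) (u v : Fin n) : Turing.Tape Sym :=
  if (s u).state = M.send then
    if h : (N.ports u).idxOf v < Δ then
      Turing.Tape.mk' (Turing.ListBlank.mk []) ((s u).tape (.send ⟨_, h⟩)).right₀
    else blankTape
  else blankTape

/-- Synchronous exchange of messages; halted nodes do not change any more. -/
def NodeMachine.deliver {Δ c n : ℕ} (M : NodeMachine Δ) (N : Network Δ c n)
    (s : Fin n → NodeConfig M) (v : Fin n) : NodeConfig M :=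
  if (s v).state = M.send then
    { state := M.recv
      tape := fun t =>
        match t with
        | .send _ => blankTape
        | .recv p =>
          match (N.ports v)[(p : ℕ)]? with
          | some u => M.message N s u v
          | none => blankTape
        | t => (s v).tape t
      steps := (s v).steps }
  else s v

/-- The configurations of all nodes after `i` rounds of communication, where a node makes at most
`T` steps of local computation between two rounds. -/
def NodeMachine.exec {Δ c n a b k m : ℕ} (M : NodeMachine Δ) (N : Network Δ c n)
    (x : Labeling n a b) (rpub : Bits k) (rsec : Fin n → Bits m) (T : ℕ) :
    ℕ → Fin n → NodeConfig M
  | 0 => fun v => M.step^[T] (M.init N x rpub rsec v)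
  | i + 1 => fun v => M.step^[T] (M.deliver N (M.exec N x rpub rsec T i) v)

/-- An `r(n)`-round LOCAL algorithm for instances of `Ψ`, with public and private coins, whose
nodes run in time polynomial in the number `n` of nodes. By `halts`, on every network, input
labeling and outcome of the coins, every node returns its output within `r n` rounds, after
at most `time n` steps in total (so the bound on the steps between two rounds in `exec` never
interrupts a computation). -/
structure LocalAlgorithm (Ψ : LCL) (c : ℕ) (r : ℕ → ℕ) : Type where
  machine : NodeMachine Ψ.maxDeg
  pubLen : ℕ → ℕ
  privLen : ℕ → ℕ
  pubLen_poly : ∃ p : Polynomial ℕ, ∀ n, pubLen n ≤ p.eval n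
  privLen_poly : ∃ p : Polynomial ℕ, ∀ n, privLen n ≤ p.eval n
  time : Polynomial ℕ
  halts : ∀ (n : ℕ) (N : Network Ψ.maxDeg c n) (x : Ψ.Input n) (rpub : Bits (pubLen n))
    (rsec : Fin n → Bits (privLen n)) (v : Fin n),
    (machine.exec N x rpub rsec (time.eval n) (r n) v).state = machine.halt ∧
    (machine.exec N x rpub rsec (time.eval n) (r n) v).steps ≤ time.eval n

namespace LocalAlgorithm

variable {Ψ : LCL} {c : ℕ} {r : ℕ → ℕ}

/-- The output labeling that is returned. The output tape of a node holds, from the head rightwards,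
the code of the label of the node and the codes of the labels of its half-edges, in the order of
the ports. -/
def run (A : LocalAlgorithm Ψ c r) {n : ℕ} (N : Network Ψ.maxDeg c n) (x : Ψ.Input n)
    (rpub : Bits (A.pubLen n)) (rsec : Fin n → Bits (A.privLen n)) : Ψ.Output n :=
  let cell : Fin n → ℕ → Bool := fun v i => decide
    (((A.machine.exec N x rpub rsec (A.time.eval n) (r n) v).tape .out).nth i = Sym.bit true)
  { node := fun v => decodeLabel Ψ.nodeOut_pos (fun i => cell v i)
    half := fun v u => decodeLabel Ψ.halfOut_pos (fun i =>
      cell v (Nat.size Ψ.nodeOut + (N.ports v).idxOf u * Nat.size Ψ.halfOut + i)) }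

/-- The output labeling that is returned is valid. -/
def IsValid (A : LocalAlgorithm Ψ c r) {n : ℕ} (N : Network Ψ.maxDeg c n) (x : Ψ.Input n)
    (rpub : Bits (A.pubLen n)) (rsec : Fin n → Bits (A.privLen n)) : Prop :=
  Ψ.IsSolution N.graph x (A.run N x rpub rsec)

end LocalAlgorithm

/-! ### Adversaries in the preset public coins model -/

/-- The wires that carry the binary code of an input labeling. -/
abbrev LCL.InputWire (Ψ : LCL) (n : ℕ) : Type :=
  (Fin n × Fin (Nat.size Ψ.nodeIn)) ⊕ (Fin n × Fin n × Fin (Nat.size Ψ.halfIn))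

/-- The input labeling with a given binary code. -/
def LCL.decodeInput (Ψ : LCL) {n : ℕ} (y : Ψ.InputWire n → Bool) : Ψ.Input n where
  node v := decodeLabel Ψ.nodeIn_pos (fun i => y (Sum.inl (v, i)))
  half v u := decodeLabel Ψ.halfIn_pos (fun i => y (Sum.inr (v, u, i)))

/-- A computationally bounded adversary on `n`-vertex networks: it maps the public coins, with the
help of coins of its own, to an input labeling. -/
abbrev BoundedAdversary {Ψ : LCL} {c : ℕ} {r : ℕ → ℕ} (A : LocalAlgorithm Ψ c r) (n : ℕ) : Type :=
  RandCircuit (Fin (A.pubLen n)) (Ψ.InputWire n)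

/-- An unbounded adversary: any function from the public coins to the input labelings. -/
abbrev UnboundedAdversary {Ψ : LCL} {c : ℕ} {r : ℕ → ℕ} (A : LocalAlgorithm Ψ c r) (n : ℕ) :
    Type :=
  Bits (A.pubLen n) → Ψ.Input n

/-- Success probability of `A` on `N` against a bounded adversary, over the coins of the adversary,
the public coins and the private coins. -/
noncomputable def boundedSuccess {Ψ : LCL} {c : ℕ} {r : ℕ → ℕ} (A : LocalAlgorithm Ψ c r) {n : ℕ}
    (N : Network Ψ.maxDeg c n) (B : BoundedAdversary A n) : ℝ :=
  prob (fun ω : Bits B.coins × Bits (A.pubLen n) × (Fin n → Bits (A.privLen n)) =>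
    A.IsValid N (Ψ.decodeInput (B.run ω.2.1 ω.1)) ω.2.1 ω.2.2)

/-- Failure probability of `A` on `N` against an unbounded adversary, over the public coins and the
private coins. -/
noncomputable def unboundedFailure {Ψ : LCL} {c : ℕ} {r : ℕ → ℕ} (A : LocalAlgorithm Ψ c r) {n : ℕ}
    (N : Network Ψ.maxDeg c n) (B : UnboundedAdversary A n) : ℝ :=
  prob (fun ω : Bits (A.pubLen n) × (Fin n → Bits (A.privLen n)) =>
    ¬ A.IsValid N (B ω.1) ω.1 ω.2)

/-- `A` solves `Ψ` with probability `1 - ε(n)` against bounded adversaries: for every family of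
adversaries `B n N` of polynomial size, which may depend on the network `N`, and for all large
enough `n`, on every `n`-vertex network. -/
def SolvesAgainstBounded {Ψ : LCL} {c : ℕ} {r : ℕ → ℕ} (A : LocalAlgorithm Ψ c r)
    (ε : ℕ → ℝ) : Prop :=
  ∀ (T : Polynomial ℕ) (B : ∀ n, Network Ψ.maxDeg c n → BoundedAdversary A n),
    (∀ n N, (B n N).circuit.size ≤ T.eval n) →
    ∀ᶠ n in Filter.atTop, ∀ N : Network Ψ.maxDeg c n, 1 - ε n ≤ boundedSuccess A N (B n N)

/-! ### Search problems and average-case hardness -/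

/-- The class TFNP/poly of total search problems: solutions have polynomial length, they are
verified by circuits of polynomial size, and every instance has one. -/
structure InTFNPpoly (S : List Bool → List Bool → Prop) : Prop where
  bounded : ∃ p : Polynomial ℕ, ∀ x w, S x w → w.length ≤ p.eval x.length
  verifiable : ∃ q : Polynomial ℕ, ∀ ℓ m : ℕ, ∃ C : Circuit (Fin ℓ ⊕ Fin m) Unit,
    C.size ≤ q.eval (ℓ + m) ∧ ∀ (x : Bits ℓ) (w : Bits m),
      C.eval (Sum.elim x w) () = true ↔ S (List.ofFn x) (List.ofFn w)
  total : ∀ x, ∃ w, S x w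

/-- `F` is a length-preserving polynomial-time sampler of the ensemble `D`: on uniformly random
coins of length `ℓ`, its output is distributed according to `D ℓ`. -/
structure IsSampler (F : List Bool → List Bool) (D : ∀ ℓ : ℕ, PMF (Bits ℓ)) : Prop where
  polyTime : Nonempty (Turing.TM2ComputableInPolyTime
    (id : List Bool → List Bool) (id : List Bool → List Bool) F)
  length_eq : ∀ w, (F w).length = w.length
  law : ∀ (ℓ : ℕ) (x : Bits ℓ),
    (D ℓ x).toReal = prob (fun ω : Bits ℓ => F (List.ofFn ω) = List.ofFn x)

/-- A non-uniform probabilistic solver on instances of length `ℓ`. It reads the instance and the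
coins with which the instance was sampled. It outputs a string of at most `maxLen` bits: on the
wires `inl i` the bits, and on the wires `inr i` whether position `i` is still part of the
string. -/
structure Solver (ℓ : ℕ) : Type where
  maxLen : ℕ
  prog : RandCircuit (Fin ℓ ⊕ Fin ℓ) (Fin maxLen ⊕ Fin maxLen)

/-- The string that a solver outputs on instance `x`, sampling coins `ρ` and own coins `ω`. -/
def Solver.run {ℓ : ℕ} (A : Solver ℓ) (x ρ : Bits ℓ) (ω : Bits A.prog.coins) : List Bool :=
  let y := A.prog.run (Sum.elim x ρ) ω
  ((List.finRange A.maxLen).takeWhile (fun i => y (Sum.inr i))).map (fun i => y (Sum.inl i))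

/-- The instance of length `ℓ` sampled by `F` with coins `ρ`. -/
def sample (F : List Bool → List Bool) {ℓ : ℕ} (ρ : Bits ℓ) : Bits ℓ :=
  fun i => (F (List.ofFn ρ)).getD i false

/-- The probability, over the sampling of an instance `x` and the coins of the solver, that the
solver finds a solution of `x` or `x` has none. -/
noncomputable def winProb (S : List Bool → List Bool → Prop) (F : List Bool → List Bool) {ℓ : ℕ}
    (A : Solver ℓ) : ℝ :=
  prob (fun ω : Bits ℓ × Bits A.prog.coins =>
    (∃ w, S (List.ofFn (sample F ω.1)) w) →
      S (List.ofFn (sample F ω.1)) (A.run (sample F ω.1) ω.1 ω.2))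

/-- Public-coin infinitely-often polynomial hardness-on-average against non-uniform solvers, for
the search problem `S` with instances sampled by `F`: for every polynomial `T` there is a negligible
`μ` such that every solver of size `T` wins with probability less than `μ` for infinitely many
instance lengths. -/
def PublicCoinIOHard (S : List Bool → List Bool → Prop) (F : List Bool → List Bool) : Prop :=
  ∀ T : Polynomial ℕ, ∃ μ : ℕ → ℝ, Negligible μ ∧
    ∀ A : (ℓ : ℕ) → Solver ℓ, (∀ ℓ, (A ℓ).prog.circuit.size ≤ T.eval ℓ) →
      ∃ᶠ ℓ in Filter.atTop, winProb S F (A ℓ) < μ ℓ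

end PresetCoins

open PresetCoins

/-! Failures of the algorithm exist for many values of the public coins, since an unbounded
adversary finds them, but they are hard to find, since bounded adversaries do not. Hence the search
problem: given a public string, find (the code of) an input labeling on which the algorithm fails.
Three obstacles separate this from a total problem with a deterministic verifier, and non-uniform
advice removes each of them.

Validity depends on the private coins. By a union bound over all pairs (public coins, labeling)
there is one polynomial-size table of private coins, arranged in rows, such that the test "every row
contains a failing sample" accepts each pair whose failure probability is at least `1/(2p)` and
accepts only pairs whose failure probability exceeds `1/(2s)` (`exists_samples`).

Not every public string admits a bad labeling. By averaging, those with failure probability at least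
`1/(2p)` have density at least `1/(2p)` (`half_le_prob`), so polynomially many xor-translates of
this set cover all strings, as in Lautemann's argument (`exists_shifts`). An instance `x` asks for a
labeling that passes the test at one of the translates of `x`; such a labeling always exists
(`exists_advice`).

The verifier must be a small circuit. It simulates the machines of all nodes on a window of the
tapes, with network, samples and translates hardwired (`exists_isValid_cost`,
`exists_failsOn_cost`). The number of rounds `r n` is not assumed polynomial; but a node that makes
no step between two rounds never makes one again, so after more rounds than the time bound the
output is final (`exec_out_eq`).

For hardness, instances are uniform strings and the sampler is the identity, so the sampling coins
reveal nothing beyond the instance. A solver that wins with probability `w` becomes a bounded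
adversary: fix the best of the `M` translates, undo it on the given public coins, pad, run the
solver (`exists_advantage`). The algorithm then fails with probability at least `w / M * (1/(2s))`
(`exists_adversary`), which is at most `ε n` for large `n`. So `w ≤ 2 M s ε` is negligible on the
infinitely many lengths that come from hard `n`. -/

namespace PresetCoins

/-! ### Building circuits -/

section Circuits

variable {α : Type}

/-- The values of all gates of a straight-line program. -/
def gateVals (gs : List (Gate α)) (x : α → Bool) : List Bool :=
  gs.foldl (fun w g => w ++ [g.eval x w]) []

theorem gateVals_concat (gs : List (Gate α)) (g : Gate α) (x : α → Bool) :
    gateVals (gs ++ [g]) x = gateVals gs x ++ [g.eval x (gateVals gs x)] := by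
  simp [gateVals, List.foldl_append]

theorem length_gateVals (gs : List (Gate α)) (x : α → Bool) :
    (gateVals gs x).length = gs.length := by
  induction gs using List.reverseRecOn with
  | nil => rfl
  | append_singleton gs g ih => simp [gateVals_concat, ih]

theorem gateVals_prefix {gs gs' : List (Gate α)} (h : gs <+: gs') (x : α → Bool) :
    gateVals gs x <+: gateVals gs' x := by
  obtain ⟨e, rfl⟩ := h
  induction e using List.reverseRecOn with
  | nil => simp
  | append_singleton e g ih =>
    rw [← List.append_assoc, gateVals_concat]
    exact ih.trans (List.prefix_append _ _)

theorem gateVals_getD {gs gs' : List (Gate α)} (h : gs <+: gs') (x : α → Bool) {i : ℕ}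
    (hi : i < gs.length) : (gateVals gs' x).getD i false = (gateVals gs x).getD i false := by
  obtain ⟨e, he⟩ := gateVals_prefix h x
  rw [← he, List.getD_append _ _ _ _ (by rwa [length_gateVals])]

theorem gateVals_getD_concat (gs : List (Gate α)) (g : Gate α) (x : α → Bool) :
    (gateVals (gs ++ [g]) x).getD gs.length false = g.eval x (gateVals gs x) := by
  rw [gateVals_concat, List.getD_append_right _ _ _ _ (by simp [length_gateVals])]
  simp [length_gateVals]

/-- Some gate of the program computes the predicate `P`. -/
def Avail (gs : List (Gate α)) (P : (α → Bool) → Prop) : Prop :=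
  ∃ i < gs.length, ∀ x, (gateVals gs x).getD i false = true ↔ P x

theorem Avail.mono {gs gs' : List (Gate α)} {P : (α → Bool) → Prop} (h : Avail gs P)
    (hp : gs <+: gs') : Avail gs' P := by
  obtain ⟨i, hi, hP⟩ := h
  exact ⟨i, hi.trans_le hp.length_le, fun x => by rw [gateVals_getD hp x hi, hP]⟩

theorem Avail.of_gate {gs : List (Gate α)} {P : (α → Bool) → Prop} (g : Gate α)
    (h : ∀ x, g.eval x (gateVals gs x) = true ↔ P x) : Avail (gs ++ [g]) P :=
  ⟨gs.length, by simp, fun x => by rw [gateVals_getD_concat, h]⟩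

/-- Every program that computes the predicates in `F` can be extended by at most `m` gates to one
that computes the predicates in `G`. -/
def Derives (F : Set ((α → Bool) → Prop)) (m : ℕ) (G : Set ((α → Bool) → Prop)) : Prop :=
  ∀ gs : List (Gate α), (∀ P ∈ F, Avail gs P) →
    ∃ gs', gs <+: gs' ∧ gs'.length ≤ gs.length + m ∧ ∀ P ∈ G, Avail gs' P

/-! ### Calculus of circuit extensions with cost bounds -/

namespace Derives

variable {F F' G G' H : Set ((α → Bool) → Prop)} {m m' : ℕ}

theorem of_subset (h : G ⊆ F) : Derives F 0 G :=
  fun gs hF => ⟨gs, List.prefix_rfl, by simp, fun P hP => hF P (h hP)⟩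

theorem mono (h : Derives F m G) (hF : F ⊆ F') (hm : m ≤ m') (hG : G' ⊆ G) :
    Derives F' m' G' := by
  intro gs hgs
  obtain ⟨gs', h1, h2, h3⟩ := h gs (fun P hP => hgs P (hF hP))
  exact ⟨gs', h1, by omega, fun P hP => h3 P (hG hP)⟩

theorem mono_left (h : Derives F m G) (hF : F ⊆ F') : Derives F' m G := h.mono hF le_rfl le_rfl

theorem mono_cost (h : Derives F m G) (hm : m ≤ m') : Derives F m' G := h.mono le_rfl hm le_rfl

theorem mono_right (h : Derives F m G) (hG : G' ⊆ G) : Derives F m G' := h.mono le_rfl le_rfl hG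

/-- Values computed earlier stay available when gates are appended, so the second stage may use both
the old and the new predicates. -/
theorem trans_union (h : Derives F m G) (h' : Derives (F ∪ G) m' H) : Derives F (m + m') H := by
  intro gs hgs
  obtain ⟨gs', h1, h2, h3⟩ := h gs hgs
  obtain ⟨gs'', k1, k2, k3⟩ := h' gs' (by
    rintro P (hP | hP)
    · exact (hgs P hP).mono h1
    · exact h3 P hP)
  exact ⟨gs'', h1.trans k1, by omega, k3⟩

theorem trans (h : Derives F m G) (h' : Derives G m' H) : Derives F (m + m') H :=
  h.trans_union (h'.mono_left Set.subset_union_right)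

theorem union (h : Derives F m G) (h' : Derives F m' H) : Derives F (m + m') (G ∪ H) := by
  intro gs hgs
  obtain ⟨gs', h1, h2, h3⟩ := h gs hgs
  obtain ⟨gs'', k1, k2, k3⟩ := h' gs' fun P hP => (hgs P hP).mono h1
  refine ⟨gs'', h1.trans k1, by omega, ?_⟩
  rintro P (hP | hP)
  · exact (h3 P hP).mono k1
  · exact k3 P hP

theorem keep (h : Derives F m G) : Derives F m (F ∪ G) := by
  simpa using (of_subset (F := F) le_rfl).union h

theorem biUnion {ι : Type*} (s : Finset ι) {G : ι → Set ((α → Bool) → Prop)}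
    (h : ∀ i ∈ s, Derives F m (G i)) : Derives F (s.card * m) (⋃ i ∈ s, G i) := by
  classical
  induction s using Finset.induction_on with
  | empty => simpa using of_subset (F := F) (Set.empty_subset F)
  | insert a s ha ih =>
    have h1 := (h a (Finset.mem_insert_self a s)).union
      (ih fun i hi => h i (Finset.mem_insert_of_mem hi))
    rw [Finset.card_insert_of_notMem ha, Finset.set_biUnion_insert]
    exact h1.mono_cost (by rw [add_mul, one_mul, add_comm])

theorem iUnion {ι : Type*} [Fintype ι] {G : ι → Set ((α → Bool) → Prop)}
    (h : ∀ i, Derives F m (G i)) : Derives F (Fintype.card ι * m) (⋃ i, G i) := by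
  simpa using biUnion Finset.univ fun i _ => h i

theorem range {ι : Type*} [Fintype ι] {P : ι → (α → Bool) → Prop}
    (h : ∀ i, Derives F m {P i}) : Derives F (Fintype.card ι * m) (Set.range P) := by
  simpa using iUnion h

theorem single {P : (α → Bool) → Prop} (g : List (Gate α) → Gate α)
    (h : ∀ gs, (∀ Q ∈ F, Avail gs Q) →
      ∀ x, (g gs).eval x (gateVals gs x) = true ↔ P x) : Derives F 1 {P} :=
  fun gs hgs => ⟨gs ++ [g gs], List.prefix_append _ _, by simp, by
    rintro Q rfl
    exact Avail.of_gate (g gs) (h gs hgs)⟩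

/-- The gate is chosen classically, so any fixed fact costs one gate, decidable or not. This is
where non-uniform advice enters. -/
theorem const (p : Prop) : Derives F 1 {fun _ : α → Bool => p} := by
  classical
  exact single (fun _ => .const (decide p)) fun gs _ x => by simp [Gate.eval]

theorem input (a : α) : Derives F 1 {fun x : α → Bool => x a = true} :=
  single (fun _ => .input a) fun gs _ x => by simp [Gate.eval]

theorem not {P : (α → Bool) → Prop} (hP : P ∈ F) : Derives F 1 {fun x => ¬ P x} := by
  intro gs hgs
  obtain ⟨i, -, hi⟩ := hgs P hP
  refine ⟨gs ++ [.not i], List.prefix_append _ _, by simp, ?_⟩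
  rintro Q rfl
  refine Avail.of_gate _ fun x => ?_
  rw [← hi x]
  simp [Gate.eval]

theorem and {P Q : (α → Bool) → Prop} (hP : P ∈ F) (hQ : Q ∈ F) :
    Derives F 1 {fun x => P x ∧ Q x} := by
  intro gs hgs
  obtain ⟨i, -, hi⟩ := hgs P hP
  obtain ⟨j, -, hj⟩ := hgs Q hQ
  refine ⟨gs ++ [.and i j], List.prefix_append _ _, by simp, ?_⟩
  rintro Q rfl
  refine Avail.of_gate _ fun x => ?_
  rw [← hi x, ← hj x]
  simp [Gate.eval]

theorem or {P Q : (α → Bool) → Prop} (hP : P ∈ F) (hQ : Q ∈ F) :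
    Derives F 1 {fun x => P x ∨ Q x} := by
  intro gs hgs
  obtain ⟨i, -, hi⟩ := hgs P hP
  obtain ⟨j, -, hj⟩ := hgs Q hQ
  refine ⟨gs ++ [.or i j], List.prefix_append _ _, by simp, ?_⟩
  rintro Q rfl
  refine Avail.of_gate _ fun x => ?_
  rw [← hi x, ← hj x]
  simp [Gate.eval]

theorem exists_mem {ι : Type*} (s : Finset ι) {P : ι → (α → Bool) → Prop}
    (h : ∀ i ∈ s, P i ∈ F) : Derives F (s.card + 1) {fun x => ∃ i ∈ s, P i x} := by
  classical
  induction s using Finset.induction_on with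
  | empty => simpa using const (F := F) False
  | insert a s ha ih =>
    have h1 := (ih fun i hi => h i (Finset.mem_insert_of_mem hi)).trans_union
      (or (F := F ∪ _) (Or.inl (h a (Finset.mem_insert_self a s))) (Or.inr rfl))
    rw [Finset.card_insert_of_notMem ha]
    simpa using h1

theorem forall_mem {ι : Type*} (s : Finset ι) {P : ι → (α → Bool) → Prop}
    (h : ∀ i ∈ s, P i ∈ F) : Derives F (s.card + 1) {fun x => ∀ i ∈ s, P i x} := by
  classical
  induction s using Finset.induction_on with
  | empty => simpa using const (F := F) True
  | insert a s ha ih =>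
    have h1 := (ih fun i hi => h i (Finset.mem_insert_of_mem hi)).trans_union
      (and (F := F ∪ _) (Or.inl (h a (Finset.mem_insert_self a s))) (Or.inr rfl))
    rw [Finset.card_insert_of_notMem ha]
    simpa using h1

theorem exists_and {ι : Type*} [Fintype ι] (p : ι → Prop) {P : ι → (α → Bool) → Prop}
    (h : ∀ i, P i ∈ F) : Derives F (Fintype.card ι + 1) {fun x => ∃ i, p i ∧ P i x} := by
  classical
  have := exists_mem (F := F) (Finset.univ.filter p) (P := P) fun i _ => h i
  simp only [Finset.mem_filter, Finset.mem_univ, true_and] at this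
  exact this.mono_cost (Nat.succ_le_succ (Finset.card_filter_le _ _))

theorem exists' {ι : Type*} [Fintype ι] {P : ι → (α → Bool) → Prop}
    (h : ∀ i, P i ∈ F) : Derives F (Fintype.card ι + 1) {fun x => ∃ i, P i x} := by
  simpa using exists_and (fun _ => True) h

theorem forall' {ι : Type*} [Fintype ι] {P : ι → (α → Bool) → Prop}
    (h : ∀ i, P i ∈ F) : Derives F (Fintype.card ι + 1) {fun x => ∀ i, P i x} := by
  simpa using forall_mem Finset.univ (P := P) fun i _ => h i

/-- Iterated quantifiers over families of predicates, each of which is derived at cost `m`. -/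
theorem exists_of {ι : Type*} [Fintype ι] {P : ι → (α → Bool) → Prop}
    (h : ∀ i, Derives F m {P i}) :
    Derives F (Fintype.card ι * m + (Fintype.card ι + 1)) {fun x => ∃ i, P i x} :=
  (range h).trans (exists' fun i => ⟨i, rfl⟩)

theorem forall_of {ι : Type*} [Fintype ι] {P : ι → (α → Bool) → Prop}
    (h : ∀ i, Derives F m {P i}) :
    Derives F (Fintype.card ι * m + (Fintype.card ι + 1)) {fun x => ∀ i, P i x} :=
  (range h).trans (forall' fun i => ⟨i, rfl⟩)

theorem and_of {P Q : (α → Bool) → Prop} (h : Derives F m {P}) (h' : Derives F m' {Q}) :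
    Derives F (m + m' + 1) {fun x => P x ∧ Q x} :=
  (h.union h').trans (and (Or.inl rfl) (Or.inr rfl))

theorem not_of {P : (α → Bool) → Prop} (h : Derives F m {P}) :
    Derives F (m + 1) {fun x => ¬ P x} :=
  h.trans (not rfl)

end Derives

/-- The predicates that say which value `f` takes. -/
def oneHot {Γ : Type*} (f : (α → Bool) → Γ) : Set ((α → Bool) → Prop) :=
  Set.range fun γ x => f x = γ

theorem mem_oneHot {Γ : Type*} (f : (α → Bool) → Γ) (γ : Γ) : (fun x => f x = γ) ∈ oneHot f :=
  ⟨γ, rfl⟩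

/-! ### Functions with finitely many values, in one-hot form -/

namespace Derives

variable {F : Set ((α → Bool) → Prop)} {Γ Γ' : Type*} [Fintype Γ] [Fintype Γ']

/-- A disjunction over the values that satisfy `p`. The cost depends only on the size of the value
type, so every operation on a bounded amount of data costs a constant number of gates. -/
theorem pred_of_oneHot {f : (α → Bool) → Γ} (hf : oneHot f ⊆ F) (p : Γ → Prop) :
    Derives F (Fintype.card Γ + 1) {fun x => p (f x)} := by
  simpa using exists_and p fun γ => hf (mem_oneHot f γ)

theorem oneHot_map {f : (α → Bool) → Γ} (hf : oneHot f ⊆ F) (h : Γ → Γ') :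
    Derives F (Fintype.card Γ' * (Fintype.card Γ + 1)) (oneHot fun x => h (f x)) :=
  range fun γ' => pred_of_oneHot hf fun γ => h γ = γ'

theorem oneHot_prod {f : (α → Bool) → Γ} {g : (α → Bool) → Γ'} (hf : oneHot f ⊆ F)
    (hg : oneHot g ⊆ F) :
    Derives F (Fintype.card Γ * Fintype.card Γ') (oneHot fun x => (f x, g x)) := by
  have := range (F := F) (ι := Γ × Γ') (m := 1) (P := fun c x => (f x, g x) = c) fun c => by
    simpa [Prod.ext_iff] using and (hf (mem_oneHot f c.1)) (hg (mem_oneHot g c.2))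
  rwa [Fintype.card_prod, mul_one] at this

theorem oneHot_pi {κ : Type*} [Fintype κ] [DecidableEq κ] {f : κ → (α → Bool) → Γ}
    (hf : ∀ k, oneHot (f k) ⊆ F) :
    Derives F (Fintype.card (κ → Γ) * (Fintype.card κ + 1)) (oneHot fun x k => f k x) :=
  range fun c => by
    simpa [funext_iff] using forall' fun k => hf k (mem_oneHot (f k) (c k))

end Derives

/-- A program for a predicate yields a circuit. -/
theorem Derives.circuit {m : ℕ} {P : (α → Bool) → Prop} (h : Derives ∅ m {P}) :
    ∃ C : Circuit α Unit, C.size ≤ m ∧ ∀ x, C.eval x () = true ↔ P x := by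
  obtain ⟨gs, -, hl, hP⟩ := h [] (by simp)
  obtain ⟨i, -, hi⟩ := hP P rfl
  exact ⟨⟨gs, fun _ => i⟩, by simpa [Circuit.size] using hl, hi⟩

/-- Substitution of predicates that are already computed for the inputs of a gate, where the
earlier gates of the program are shifted by `o`. -/
def Gate.subst {β : Type} (pos : β → ℕ) (o : ℕ) : Gate β → Gate α
  -- An `or` of a gate with itself copies its value.
  | .input b => .or (pos b) (pos b)
  | .const b => .const b
  | .not i => .not (o + i)
  | .and i j => .and (o + i) (o + j)
  | .or i j => .or (o + i) (o + j)

/-- The appended block sees its own values at offset `gs.length`. Dangling references agree too,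
because both sides then read the default `false`. -/
theorem gateVals_subst {β : Type} (gs : List (Gate α)) (pos : β → ℕ)
    (hpos : ∀ b, pos b < gs.length) (f : (α → Bool) → β → Bool)
    (hf : ∀ x b, (gateVals gs x).getD (pos b) false = f x b) (hs : List (Gate β)) (x : α → Bool) :
    gateVals (gs ++ hs.map (Gate.subst pos gs.length)) x = gateVals gs x ++ gateVals hs (f x) := by
  induction hs using List.reverseRecOn with
  | nil => simp [gateVals]
  | append_singleton hs h ih =>
    have key : ∀ i, (gateVals gs x ++ gateVals hs (f x)).getD (gs.length + i) false =
        (gateVals hs (f x)).getD i false := by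
      intro i
      rw [List.getD_append_right _ _ _ _ (by simp [length_gateVals])]
      simp [length_gateVals]
    have key' : ∀ b, (gateVals gs x ++ gateVals hs (f x)).getD (pos b) false = f x b := by
      intro b
      rw [List.getD_append _ _ _ _ (by simpa [length_gateVals] using hpos b), hf]
    rw [List.map_append, ← List.append_assoc, List.map_singleton, gateVals_concat, ih,
      gateVals_concat, List.append_assoc]
    congr 2
    cases h <;> simp only [Gate.subst, Gate.eval, key, key', Bool.or_self]

/-- A circuit whose inputs are fed with derived predicates. -/
theorem exists_circuit_subst {β γ δ : Type} {m : ℕ} {f : (α → Bool) → β → Bool}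
    (h : Derives ∅ m {P | ∃ b, P = fun x => f x b = true}) (C : Circuit β γ) (ι : δ → γ) :
    ∃ C' : Circuit α δ, C'.size ≤ m + C.size ∧ ∀ x d, C'.eval x d = C.eval (f x) (ι d) := by
  obtain ⟨gs, -, hl, hP⟩ := h [] (by simp)
  have hP' : ∀ b, Avail gs (fun x => f x b = true) := fun b => hP _ ⟨b, rfl⟩
  choose pos hpos hval using hP'
  refine ⟨⟨gs ++ C.gates.map (Gate.subst pos gs.length), fun d => gs.length + C.out (ι d)⟩, ?_, ?_⟩
  · simpa [Circuit.size] using hl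
  · intro x d
    change (gateVals (gs ++ C.gates.map (Gate.subst pos gs.length)) x).getD _ _ = _
    rw [gateVals_subst gs pos hpos f (fun x b => by rw [Bool.eq_iff_iff]; exact hval b x),
      List.getD_append_right _ _ _ _ (by simp [length_gateVals])]
    simp only [length_gateVals, Nat.add_sub_cancel_left]
    rfl

end Circuits

/-! ### Simulation of the machines of a network by circuits -/

section Simulation

instance : Fintype Sym where
  elems := {.blank, .sep, .bit false, .bit true}
  complete := by rintro (_ | _ | _ | _) <;> simp

instance (Δ : ℕ) : Finite (TapeId Δ) := by
  refine Finite.of_surjective (α := Fin 5 ⊕ Fin Δ ⊕ Fin Δ) (Sum.elim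
    ![TapeId.input, TapeId.priv, TapeId.pub, TapeId.work, TapeId.out]
    (Sum.elim TapeId.send TapeId.recv)) ?_
  rintro (_ | _ | _ | _ | _ | p | p)
  · exact ⟨Sum.inl 0, rfl⟩
  · exact ⟨Sum.inl 1, rfl⟩
  · exact ⟨Sum.inl 2, rfl⟩
  · exact ⟨Sum.inl 3, rfl⟩
  · exact ⟨Sum.inl 4, rfl⟩
  · exact ⟨Sum.inr (Sum.inl p), rfl⟩
  · exact ⟨Sum.inr (Sum.inr p), rfl⟩

noncomputable instance (Δ : ℕ) : Fintype (TapeId Δ) := Fintype.ofFinite _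

noncomputable instance (Δ : ℕ) : DecidableEq (TapeId Δ) := Classical.decEq _

theorem tape_mk'_nil_nth (R : Turing.ListBlank Sym) (j : ℤ) :
    (Turing.Tape.mk' (Turing.ListBlank.mk []) R).nth j =
      if 0 ≤ j then R.nth j.toNat else Sym.blank := by
  obtain k | k := j
  · exact (Turing.Tape.mk'_nth_nat _ R k).trans (by simp)
  · rw [if_neg (by simp)]
    rfl

theorem blankTape_nth (j : ℤ) : blankTape.nth j = Sym.blank := by
  rw [blankTape, Turing.Tape.mk₁, Turing.Tape.mk₂, tape_mk'_nil_nth]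
  split_ifs
  · rw [Turing.ListBlank.nth_mk, List.getI_nil]
    rfl
  · rfl

/-- Cells are numbered relative to the head, so a move renumbers the tape: the symbol just written
ends up at position `1` after a move to the left and at `-1` after a move to the right. -/
theorem act_nth (T : Turing.Tape Sym) (a : Sym × Option Turing.Dir) (j : ℤ) :
    (act T a).nth j = match a.2 with
      | none => if j = 0 then a.1 else T.nth j
      | some .left => if j = 1 then a.1 else T.nth (j - 1)
      | some .right => if j = -1 then a.1 else T.nth (j + 1) := by
  obtain ⟨b, _ | _ | _⟩ := a
  · simp [act, Turing.Tape.write_nth]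
  · simp only [act, Turing.Tape.move_left_nth, Turing.Tape.write_nth, sub_eq_zero]
  · simp only [act, Turing.Tape.move_right_nth, Turing.Tape.write_nth, add_eq_zero_iff_eq_neg]

variable {α : Type} {Δ c n : ℕ} {M : NodeMachine Δ}

/-- The predicates that describe the states of all nodes and the tape cells at distance at most `W`
from the heads. -/
def knownConfig (W : ℕ) (s : (α → Bool) → Fin n → NodeConfig M) : Set ((α → Bool) → Prop) :=
  (⋃ v, oneHot fun x => (s x v).state) ∪
    ⋃ v, ⋃ t, ⋃ j ∈ Finset.Icc (-(W : ℤ)) W, oneHot fun x => ((s x v).tape t).nth j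

theorem oneHot_state_subset (W : ℕ) (s : (α → Bool) → Fin n → NodeConfig M) (v : Fin n) :
    (oneHot fun x => (s x v).state) ⊆ knownConfig W s :=
  (Set.subset_iUnion (fun v => oneHot fun x => (s x v).state) v).trans Set.subset_union_left

theorem oneHot_cell_subset {W : ℕ} (s : (α → Bool) → Fin n → NodeConfig M) (v : Fin n)
    (t : TapeId Δ) {j : ℤ} (hj : j ∈ Finset.Icc (-(W : ℤ)) W) :
    (oneHot fun x => ((s x v).tape t).nth j) ⊆ knownConfig W s := by
  intro P hP
  refine Or.inr ?_
  simp only [Set.mem_iUnion]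
  exact ⟨v, t, j, hj, hP⟩

theorem knownConfig_subset {W : ℕ} {s : (α → Bool) → Fin n → NodeConfig M}
    {F : Set ((α → Bool) → Prop)} (h : ∀ v, (oneHot fun x => (s x v).state) ⊆ F)
    (h' : ∀ v t, ∀ j ∈ Finset.Icc (-(W : ℤ)) W, (oneHot fun x => ((s x v).tape t).nth j) ⊆ F) :
    knownConfig W s ⊆ F := by
  refine Set.union_subset (Set.iUnion_subset h) ?_
  simp only [Set.iUnion_subset_iff]
  exact h'

theorem Derives.knownConfig {W a b : ℕ} {s : (α → Bool) → Fin n → NodeConfig M}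
    {F : Set ((α → Bool) → Prop)} (h : ∀ v, Derives F a (oneHot fun x => (s x v).state))
    (h' : ∀ v t, ∀ j ∈ Finset.Icc (-(W : ℤ)) W,
      Derives F b (oneHot fun x => ((s x v).tape t).nth j)) :
    Derives F (n * a + n * (Fintype.card (TapeId Δ) * ((2 * W + 1) * b)))
      (knownConfig W s) := by
  refine Derives.union ?_ ?_
  · simpa using Derives.iUnion h
  · have := Derives.iUnion fun v => Derives.iUnion fun t => Derives.biUnion _ (h' v t)
    rw [Int.card_Icc, Fintype.card_fin] at this
    convert this using 5
    omega

/-- Functions of two values. -/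
theorem Derives.oneHot_map₂ {F : Set ((α → Bool) → Prop)} {A B C : Type*} [Fintype A] [Fintype B]
    [Fintype C] {f : (α → Bool) → A} {g : (α → Bool) → B} (hf : oneHot f ⊆ F) (hg : oneHot g ⊆ F)
    (h : A → B → C) :
    Derives F (Fintype.card A * Fintype.card B +
      Fintype.card C * (Fintype.card (A × B) + 1)) (oneHot fun x => h (f x) (g x)) :=
  (Derives.oneHot_prod hf hg).trans (Derives.oneHot_map le_rfl fun c : A × B => h c.1 c.2)

/-- Functions of four values. -/
theorem Derives.oneHot_map₄ (A B C D E : Type*) [Fintype A] [Fintype B] [Fintype C] [Fintype D]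
    [Fintype E] : ∃ m, ∀ {α : Type} {F : Set ((α → Bool) → Prop)} {f₁ : (α → Bool) → A}
      {f₂ : (α → Bool) → B} {f₃ : (α → Bool) → C} {f₄ : (α → Bool) → D}, oneHot f₁ ⊆ F →
      oneHot f₂ ⊆ F → oneHot f₃ ⊆ F → oneHot f₄ ⊆ F → ∀ h : A → B → C → D → E,
      Derives F m (oneHot fun x => h (f₁ x) (f₂ x) (f₃ x) (f₄ x)) :=
  ⟨_, fun h₁ h₂ h₃ h₄ h => ((Derives.oneHot_prod h₁ h₂).union (Derives.oneHot_prod h₃ h₄)).trans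
    (Derives.oneHot_map₂ Set.subset_union_left Set.subset_union_right
      fun (a : A × B) (b : C × D) => h a.1 a.2 b.1 b.2)⟩

/-- One step of all nodes, restricted to a window of the tapes. -/
theorem exists_step_cost (M : NodeMachine Δ) :
    ∃ a, ∀ {α : Type} {n : ℕ} (W : ℕ) (s : (α → Bool) → Fin n → NodeConfig M),
      Derives (knownConfig (W + 1) s) (a * n * (2 * W + 1))
        (knownConfig W fun x v => M.step (s x v)) := by
  obtain ⟨a₁, h₁⟩ := Derives.oneHot_map₄ (Fin M.states × (TapeId Δ → Sym)) Sym Sym Sym Sym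
  let b₁ := Fintype.card (TapeId Δ → Sym) * (Fintype.card (TapeId Δ) + 1)
  let b₂ := Fintype.card (Fin M.states) * Fintype.card (TapeId Δ → Sym)
  let a₂ := Fintype.card (Fin M.states) *
    (Fintype.card (Fin M.states × (TapeId Δ → Sym)) + 1)
  refine ⟨b₁ + b₂ + a₂ + Fintype.card (TapeId Δ) * a₁, fun {α n} W s => ?_⟩
  -- The state and all head symbols become one value, in a type whose size depends only on `M`; this
  -- is all that the transition function reads.
  have hhead : ∀ v : Fin n, Derives (knownConfig (W + 1) s) (b₁ + b₂)
      (oneHot fun x => ((s x v).state, fun t => ((s x v).tape t).head)) := fun v => by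
    refine Derives.trans_union (Derives.oneHot_pi (f := fun t x => ((s x v).tape t).head)
      fun t => ?_) (Derives.oneHot_prod ((oneHot_state_subset _ s v).trans
        Set.subset_union_left) Set.subset_union_right)
    simpa using oneHot_cell_subset (W := W + 1) s v t (j := 0) (by simp; omega)
  have hall := (Derives.iUnion hhead).keep
  have hin : ∀ v : Fin n, (oneHot fun x => ((s x v).state, fun t => ((s x v).tape t).head)) ⊆
      ⋃ v, oneHot fun x => ((s x v).state, fun t => ((s x v).tape t).head) :=
    fun v => Set.subset_iUnion (fun v : Fin n =>
      oneHot fun x => ((s x v).state, fun t => ((s x v).tape t).head)) v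
  have hstep := Derives.knownConfig (W := W) (a := a₂) (b := a₁)
    (s := fun x v => M.step (s x v)) (F := _)
    (fun v => by
      have := Derives.oneHot_map (Set.subset_union_of_subset_right (hin v) (knownConfig (W + 1) s))
        (fun q => if q.1 = M.send ∨ q.1 = M.halt then q.1 else (M.trans q.1 q.2).1)
      convert this using 3 with x
      simp only [NodeMachine.step]
      split_ifs <;> rfl)
    (fun v t j hj => by
      rw [Finset.mem_Icc] at hj
      -- A cell after the step is determined by the transition and by its old content and that of
      -- its two neighbours, so each step consumes one cell of the window on either side.
      have hc : ∀ i : ℤ, -1 ≤ i → i ≤ 1 → (oneHot fun x => ((s x v).tape t).nth (j + i)) ⊆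
          knownConfig (W + 1) s := fun i h h' =>
        oneHot_cell_subset s v t (by rw [Finset.mem_Icc]; push_cast; omega)
      have := h₁ (Set.subset_union_of_subset_right (hin v) (knownConfig (W + 1) s))
        (Set.subset_union_of_subset_left (hc (-1) (by simp) (by simp)) _)
        (Set.subset_union_of_subset_left (hc 0 (by simp) (by simp)) _)
        (Set.subset_union_of_subset_left (hc 1 (by simp) (by simp)) _)
        (fun q l m r => if q.1 = M.send ∨ q.1 = M.halt then m else
          match ((M.trans q.1 q.2).2 t).2 with
          | none => if j = 0 then ((M.trans q.1 q.2).2 t).1 else m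
          | some .left => if j = 1 then ((M.trans q.1 q.2).2 t).1 else l
          | some .right => if j = -1 then ((M.trans q.1 q.2).2 t).1 else r)
      convert this using 3 with x
      by_cases hq : (s x v).state = M.send ∨ (s x v).state = M.halt
      · simp only [NodeMachine.step, add_zero, if_pos hq]
      · simp only [NodeMachine.step, add_zero, if_neg hq, ← sub_eq_add_neg]
        exact act_nth _ _ _)
  refine (hall.trans hstep).mono_cost ?_
  rw [Fintype.card_fin]
  have : 1 ≤ 2 * W + 1 := by omega
  calc n * (b₁ + b₂) + (n * a₂ + n * (Fintype.card (TapeId Δ) * ((2 * W + 1) * a₁)))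
      = (b₁ + b₂ + a₂) * n * 1 + Fintype.card (TapeId Δ) * a₁ * n * (2 * W + 1) := by ring
    _ ≤ (b₁ + b₂ + a₂) * n * (2 * W + 1) + Fintype.card (TapeId Δ) * a₁ * n * (2 * W + 1) := by
        gcongr
    _ = _ := by ring

/-- The exchange of messages, restricted to a window of the tapes. -/
theorem exists_deliver_cost (M : NodeMachine Δ) :
    ∃ a, ∀ {α : Type} {c n : ℕ} (N : Network Δ c n) (W : ℕ)
      (s : (α → Bool) → Fin n → NodeConfig M),
      Derives (knownConfig W s) (a * n * (2 * W + 1))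
        (knownConfig W fun x v => M.deliver N (s x) v) := by
  obtain ⟨a₁, h₁⟩ := Derives.oneHot_map₄ (Fin M.states) (Fin M.states) Sym Sym Sym
  let a₂ := Fintype.card (Fin M.states) * (Fintype.card (Fin M.states) + 1)
  refine ⟨a₂ + Fintype.card (TapeId Δ) * a₁, fun {α c n} N W s => ?_⟩
  have hd := Derives.knownConfig (W := W) (a := a₂) (b := a₁)
    (s := fun x v => M.deliver N (s x) v) (F := knownConfig W s)
    (fun v => by
      have := Derives.oneHot_map (oneHot_state_subset W s v)
        (fun q => if q = M.send then M.recv else q)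
      convert this using 3 with x
      simp only [NodeMachine.deliver]
      split_ifs <;> rfl)
    (fun v t j hj => by
      -- Every cell after delivery is a fixed function of two states and two old cells, with the
      -- second node and tape determined by the network alone.
      suffices ∃ (u : Fin n) (t' : TapeId Δ) (h : Fin M.states → Fin M.states → Sym → Sym → Sym),
          ∀ x, ((M.deliver N (s x) v).tape t).nth j =
            h (s x v).state (s x u).state (((s x v).tape t).nth j) (((s x u).tape t').nth j) by
        obtain ⟨u, t', h, hx⟩ := this
        simp only [hx]
        exact h₁ (oneHot_state_subset W s v) (oneHot_state_subset W s u)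
          (oneHot_cell_subset s v t hj) (oneHot_cell_subset s u t' hj) h
      have hblank : (∀ x, (s x v).state = M.send →
          ((M.deliver N (s x) v).tape t).nth j = Sym.blank) →
          ∃ (u : Fin n) (t' : TapeId Δ) (h : Fin M.states → Fin M.states → Sym → Sym → Sym),
            ∀ x, ((M.deliver N (s x) v).tape t).nth j =
              h (s x v).state (s x u).state (((s x v).tape t).nth j)
                (((s x u).tape t').nth j) := by
        refine fun h => ⟨v, t, fun q _ c _ => if q = M.send then Sym.blank else c, fun x => ?_⟩
        by_cases hq : (s x v).state = M.send
        · simp [h x hq, hq]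
        · simp [NodeMachine.deliver, hq]
      have hid : (∀ x, (s x v).state = M.send →
          ((M.deliver N (s x) v).tape t).nth j = ((s x v).tape t).nth j) →
          ∃ (u : Fin n) (t' : TapeId Δ) (h : Fin M.states → Fin M.states → Sym → Sym → Sym),
            ∀ x, ((M.deliver N (s x) v).tape t).nth j =
              h (s x v).state (s x u).state (((s x v).tape t).nth j)
                (((s x u).tape t').nth j) := by
        refine fun h => ⟨v, t, fun _ _ c _ => c, fun x => ?_⟩
        by_cases hq : (s x v).state = M.send
        · simp [h x hq]
        · simp [NodeMachine.deliver, hq]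
      cases t with
      | send p => exact hblank (fun x hq => by simp [NodeMachine.deliver, hq, blankTape_nth])
      | recv p =>
        cases hp : (N.ports v)[(p : ℕ)]? with
        | none => exact hblank (fun x hq => by simp [NodeMachine.deliver, hq, hp, blankTape_nth])
        | some u =>
          by_cases hi : (N.ports u).idxOf v < Δ
          -- Only the part of the outgoing tape from the head rightwards is delivered, hence the
          -- blank for `j < 0`.
          · refine ⟨u, .send ⟨_, hi⟩, fun q q' c c' => if q = M.send then
              (if q' = M.send then (if 0 ≤ j then c' else Sym.blank) else Sym.blank) else c,
              fun x => ?_⟩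
            by_cases hq : (s x v).state = M.send
            · by_cases hq' : (s x u).state = M.send
              · simp only [NodeMachine.deliver, hq, hp, NodeMachine.message, hq', hi, dif_pos,
                  if_true, tape_mk'_nil_nth]
                split_ifs with h0
                · rw [Turing.Tape.right₀_nth, Int.toNat_of_nonneg h0]
                · rfl
              · simp [NodeMachine.deliver, hq, hp, NodeMachine.message, hq', blankTape_nth]
            · simp [NodeMachine.deliver, hq]
          · exact hblank (fun x hq => by simp [NodeMachine.deliver, hq, hp, NodeMachine.message, hi, blankTape_nth])
      | input => exact hid (fun x hq => by simp [NodeMachine.deliver, hq])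
      | priv => exact hid (fun x hq => by simp [NodeMachine.deliver, hq])
      | pub => exact hid (fun x hq => by simp [NodeMachine.deliver, hq])
      | work => exact hid (fun x hq => by simp [NodeMachine.deliver, hq])
      | out => exact hid (fun x hq => by simp [NodeMachine.deliver, hq]))
  refine hd.mono_cost ?_
  have : 1 ≤ 2 * W + 1 := by omega
  calc n * a₂ + n * (Fintype.card (TapeId Δ) * ((2 * W + 1) * a₁))
      = a₂ * n * 1 + Fintype.card (TapeId Δ) * a₁ * n * (2 * W + 1) := by ring
    _ ≤ a₂ * n * (2 * W + 1) + Fintype.card (TapeId Δ) * a₁ * n * (2 * W + 1) := by gcongr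
    _ = _ := by ring

/-- The configurations after `i` rounds. -/
theorem exists_exec_cost (M : NodeMachine Δ) :
    ∃ a, ∀ {α : Type} {c n a' b k m : ℕ} (N : Network Δ c n) (W T i : ℕ)
      (y : (α → Bool) → Labeling n a' b) (rpub : (α → Bool) → Bits k) (rsec : Fin n → Bits m),
      Derives (knownConfig (W + (i + 1) * T) fun x v => M.init N (y x) (rpub x) rsec v)
        ((i + 1) * (T + 1) * (a * n * (2 * (W + (i + 1) * T) + 1)))
        (knownConfig W fun x v => M.exec N (y x) (rpub x) rsec T i v) := by
  obtain ⟨a₁, h₁⟩ := exists_step_cost M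
  obtain ⟨a₂, h₂⟩ := exists_deliver_cost M
  refine ⟨a₁ + a₂, fun {α c n a' b k m} N W T i y rpub rsec => ?_⟩
  -- `T` steps consume `T` cells of the window and a delivery consumes none, which gives the initial
  -- width `W + (i + 1) * T`.
  have hiter : ∀ (T W : ℕ) (s : (α → Bool) → Fin n → NodeConfig M),
      Derives (knownConfig (W + T) s) (T * (a₁ * n * (2 * (W + T) + 1)))
        (knownConfig W fun x v => M.step^[T] (s x v)) := by
    intro T
    induction T with
    | zero => exact fun W s => (Derives.of_subset le_rfl).mono_cost (by simp)
    | succ T ih =>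
      intro W s
      have h := (ih (W + 1) s).trans (h₁ W fun x v => M.step^[T] (s x v))
      simp only [Function.iterate_succ_apply']
      rw [show W + (T + 1) = W + 1 + T by ring]
      refine h.mono_cost ?_
      rw [add_mul, one_mul]
      gcongr
      omega
  induction i generalizing W with
  | zero =>
    have := hiter T W fun x v => M.init N (y x) (rpub x) rsec v
    simp only [zero_add, one_mul]
    refine this.mono_cost ?_
    gcongr <;> omega
  | succ i ih =>
    have h := ((ih (W + T)).trans (h₂ N (W + T) _)).trans (hiter T W _)
    rw [show W + (i + 1 + 1) * T = W + T + (i + 1) * T by ring]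
    refine h.mono_cost ?_
    set K := 2 * (W + T + (i + 1) * T) + 1
    have hK : 2 * (W + T) + 1 ≤ K := by
      have := Nat.zero_le ((i + 1) * T)
      omega
    calc (i + 1) * (T + 1) * ((a₁ + a₂) * n * K) + a₂ * n * (2 * (W + T) + 1) +
          T * (a₁ * n * (2 * (W + T) + 1))
        ≤ (i + 1) * (T + 1) * ((a₁ + a₂) * n * K) + (a₁ + a₂) * n * K +
          T * ((a₁ + a₂) * n * K) := by
          gcongr <;> omega
      _ = _ := by ring

/-! ### The number of rounds is bounded by the running time -/

theorem step_iterate_eq_self {s : NodeConfig M} (h : s.state = M.send ∨ s.state = M.halt) (T : ℕ) :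
    M.step^[T] s = s :=
  Function.iterate_fixed (by simp [NodeMachine.step, h]) T

theorem steps_le_iterate (s : NodeConfig M) (T : ℕ) : s.steps ≤ (M.step^[T] s).steps := by
  induction T with
  | zero => rfl
  | succ T ih =>
    rw [Function.iterate_succ_apply']
    refine ih.trans ?_
    rw [NodeMachine.step]
    split_ifs <;> simp

theorem steps_lt_iterate {s : NodeConfig M} (h : ¬ (s.state = M.send ∨ s.state = M.halt)) {T : ℕ}
    (hT : 0 < T) : s.steps < (M.step^[T] s).steps := by
  obtain ⟨T, rfl⟩ := Nat.exists_eq_succ_of_ne_zero hT.ne'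
  rw [Function.iterate_succ_apply]
  refine lt_of_lt_of_le ?_ (steps_le_iterate _ T)
  simp [NodeMachine.step, h]

section Rounds

variable {a b k m : ℕ} (N : Network Δ c n) (x : Labeling n a b) (rpub : Bits k)
  (rsec : Fin n → Bits m) (T : ℕ)

theorem deliver_steps (s : Fin n → NodeConfig M) (v : Fin n) :
    (M.deliver N s v).steps = (s v).steps := by
  rw [NodeMachine.deliver]
  split_ifs <;> rfl

theorem exec_steps_mono (v : Fin n) : Monotone fun i => (M.exec N x rpub rsec T i v).steps :=
  monotone_nat_of_le_succ fun i => by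
    rw [NodeMachine.exec, ← deliver_steps N (M.exec N x rpub rsec T i)]
    exact steps_le_iterate _ _

theorem deliver_tape_out (s : Fin n → NodeConfig M) (v : Fin n) :
    (M.deliver N s v).tape .out = (s v).tape .out := by
  rw [NodeMachine.deliver]
  split_ifs <;> rfl

/-- Nodes that make no further step. -/
def Stuck (s : NodeConfig M) : Prop :=
  (s.state = M.halt ∧ M.halt ≠ M.send) ∨ (s.state = M.send ∧ M.recv = M.send)

/-- A halted node is left alone because `halt ≠ send`. A sending node is moved to `recv`, which in
the second case is `send` again, so it never computes. -/
theorem Stuck.deliver {s : Fin n → NodeConfig M} {v : Fin n} (h : Stuck (s v)) :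
    Stuck (M.deliver N s v) ∧
      ((M.deliver N s v).state = M.send ∨ (M.deliver N s v).state = M.halt) := by
  obtain ⟨h1, h2⟩ | ⟨h1, h2⟩ := h
  · rw [NodeMachine.deliver, if_neg (by rwa [h1])]
    exact ⟨Or.inl ⟨h1, h2⟩, Or.inr h1⟩
  · rw [NodeMachine.deliver, if_pos h1]
    exact ⟨Or.inr ⟨h2, h2⟩, Or.inl h2⟩

theorem exec_out_of_stuck {v : Fin n} {i j : ℕ} (hij : i ≤ j)
    (h : Stuck (M.exec N x rpub rsec T i v)) : Stuck (M.exec N x rpub rsec T j v) ∧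
    (M.exec N x rpub rsec T j v).tape .out = (M.exec N x rpub rsec T i v).tape .out := by
  induction j, hij using Nat.le_induction with
  | base => exact ⟨h, rfl⟩
  | succ j hij ih =>
    have hd := ih.1.deliver N
    simp only [NodeMachine.exec]
    rw [step_iterate_eq_self hd.2]
    exact ⟨hd.1, by rw [deliver_tape_out, ih.2]⟩

/-- A node that is in `send` or `halt` right after a delivery is stuck: delivery takes every sending
node to `recv`, so `send` can only appear if `recv = send`. Any other node makes at least one step
in the round. -/
theorem stuck_or_le_steps (hT : 0 < T) (v : Fin n) (i : ℕ) :
    Stuck (M.exec N x rpub rsec T i v) ∨ i ≤ (M.exec N x rpub rsec T i v).steps := by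
  induction i with
  | zero => simp
  | succ i ih =>
    by_cases hi : Stuck (M.exec N x rpub rsec T i v)
    · exact Or.inl (exec_out_of_stuck N x rpub rsec T i.le_succ hi).1
    have ih := ih.resolve_left hi
    simp only [NodeMachine.exec]
    by_cases hq : (M.deliver N (M.exec N x rpub rsec T i) v).state = M.send ∨
        (M.deliver N (M.exec N x rpub rsec T i) v).state = M.halt
    · left
      rw [step_iterate_eq_self hq]
      by_cases hs : (M.deliver N (M.exec N x rpub rsec T i) v).state = M.send
      · refine Or.inr ⟨hs, ?_⟩
        rw [NodeMachine.deliver] at hs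
        split_ifs at hs with h
        · exact hs
        · exact absurd hs h
      · have hh := hq.resolve_left hs
        exact Or.inl ⟨hh, fun h => hs (hh.trans h)⟩
    · right
      have := steps_lt_iterate hq hT
      rw [deliver_steps] at this
      omega

/-- The output does not change after as many rounds as there are steps. -/
theorem exec_out_eq {v : Fin n} {i : ℕ} (h : (M.exec N x rpub rsec T i v).steps ≤ T) :
    (M.exec N x rpub rsec T i v).tape .out =
      (M.exec N x rpub rsec T (min i (T + 1)) v).tape .out := by
  obtain hi | hi := le_total i (T + 1)
  · rw [min_eq_left hi]
  rw [min_eq_right hi]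
  -- For `T = 0` no local step is ever made, and deliveries do not touch the output tape.
  obtain rfl | hT := T.eq_zero_or_pos
  · have : ∀ j, (M.exec N x rpub rsec 0 j v).tape .out =
        (M.exec N x rpub rsec 0 0 v).tape .out := by
      intro j
      induction j with
      | zero => rfl
      | succ j ih => rw [← ih]; exact deliver_tape_out N _ v
    rw [this, this (0 + 1)]
  · refine (exec_out_of_stuck N x rpub rsec T hi ?_).2
    refine (stuck_or_le_steps N x rpub rsec T hT v (T + 1)).resolve_right fun h' => ?_
    have := exec_steps_mono (M := M) N x rpub rsec T v hi
    simp only at this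
    omega

end Rounds

end Simulation

/-! ### Circuits for the validity of the output of a LOCAL algorithm -/

/-- Functions that are bounded by polynomials. -/
def PolyBounded (f : ℕ → ℕ) : Prop := ∃ p : Polynomial ℕ, ∀ n, f n ≤ p.eval n

namespace PolyBounded

variable {f g : ℕ → ℕ}

theorem const (a : ℕ) : PolyBounded fun _ => a := ⟨Polynomial.C a, by simp⟩

theorem id : PolyBounded fun n => n := ⟨Polynomial.X, by simp⟩

theorem eval (p : Polynomial ℕ) : PolyBounded fun n => p.eval n := ⟨p, fun _ => le_rfl⟩

theorem add (hf : PolyBounded f) (hg : PolyBounded g) : PolyBounded fun n => f n + g n := by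
  obtain ⟨p, hp⟩ := hf
  obtain ⟨q, hq⟩ := hg
  exact ⟨p + q, fun n => by simpa using add_le_add (hp n) (hq n)⟩

theorem mul (hf : PolyBounded f) (hg : PolyBounded g) : PolyBounded fun n => f n * g n := by
  obtain ⟨p, hp⟩ := hf
  obtain ⟨q, hq⟩ := hg
  exact ⟨p * q, fun n => by simpa using Nat.mul_le_mul (hp n) (hq n)⟩

theorem of_le (hg : PolyBounded g) (h : ∀ n, f n ≤ g n) : PolyBounded f := by
  obtain ⟨q, hq⟩ := hg
  exact ⟨q, fun n => (h n).trans (hq n)⟩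

end PolyBounded

theorem eval_mono_nat (p : Polynomial ℕ) : Monotone fun n => p.eval n := by
  intro a b h
  induction p using Polynomial.induction_on' with
  | add p q hp hq => simpa using add_le_add hp hq
  | monomial k c => simpa using Nat.mul_le_mul_left c (Nat.pow_le_pow_left h k)

section Validity

variable {α : Type}

/-- The predicates that give the values of the bits `f`. -/
def knownBits {κ : Type*} (f : (α → Bool) → κ → Bool) : Set ((α → Bool) → Prop) :=
  ⋃ k, oneHot fun x => f x k

theorem oneHot_bit_subset {κ : Type*} (f : (α → Bool) → κ → Bool) (k : κ) :
    (oneHot fun x => f x k) ⊆ knownBits f :=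
  Set.subset_iUnion (fun k => oneHot fun x => f x k) k

theorem oneHot_const_subset {F : Set ((α → Bool) → Prop)} (hF : ∀ p : Prop, (fun _ => p) ∈ F)
    {Γ : Type*} (γ : Γ) : (oneHot fun _ : α → Bool => γ) ⊆ F := by
  rintro _ ⟨γ', rfl⟩
  exact hF _

/-- Lists of a fixed length, all entries of which are described by the predicates in `F`. -/
def KnownList (F : Set ((α → Bool) → Prop)) (L : (α → Bool) → List Sym) : Prop :=
  (∃ l, ∀ x, (L x).length = l) ∧ ∀ i, (oneHot fun x => (L x).getI i) ⊆ F

namespace KnownList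

variable {F : Set ((α → Bool) → Prop)} {L L' : (α → Bool) → List Sym}

theorem const (hF : ∀ p : Prop, (fun _ => p) ∈ F) (l : List Sym) : KnownList F fun _ => l :=
  ⟨⟨l.length, fun _ => rfl⟩, fun _ => oneHot_const_subset hF _⟩

theorem append (h : KnownList F L) (h' : KnownList F L') : KnownList F fun x => L x ++ L' x := by
  obtain ⟨⟨l, hl⟩, h⟩ := h
  obtain ⟨⟨l', hl'⟩, h'⟩ := h'
  refine ⟨⟨l + l', fun x => by simp [hl, hl']⟩, fun i => ?_⟩
  by_cases hi : i < l
  · convert h i using 3 with x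
    exact List.getI_append _ _ _ (by rwa [hl])
  · convert h' (i - l) using 3 with x
    rw [List.getI_append_right _ _ _ (by rw [hl]; omega), hl]

theorem cons (hF : ∀ p : Prop, (fun _ => p) ∈ F) (a : Sym) (h : KnownList F L) :
    KnownList F fun x => a :: L x :=
  (const hF [a]).append h

theorem flatMap (hF : ∀ p : Prop, (fun _ => p) ∈ F) {ι : Type*} (s : List ι)
    {K : ι → (α → Bool) → List Sym} (h : ∀ i, KnownList F (K i)) :
    KnownList F fun x => s.flatMap fun i => K i x := by
  induction s with
  | nil => exact const hF []
  | cons a s ih => exact (h a).append ih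

theorem ofFn (hF : ∀ p : Prop, (fun _ => p) ∈ F) {k : ℕ} {f : (α → Bool) → Fin k → Bool}
    (h : ∀ i, (oneHot fun x => Sym.bit (f x i)) ⊆ F) :
    KnownList F fun x => (List.ofFn (f x)).map Sym.bit := by
  refine ⟨⟨k, fun x => by simp⟩, fun i => ?_⟩
  by_cases hi : i < k
  · convert h ⟨i, hi⟩ using 3 with x
    rw [List.getI_eq_getElem _ (by simpa using hi)]
    simp
  · convert oneHot_const_subset hF (default : Sym) using 3 with x
    exact List.getI_eq_default _ (by simpa using hi)

theorem tape (hF : ∀ p : Prop, (fun _ => p) ∈ F) (h : KnownList F L) (j : ℤ) :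
    (oneHot fun x => (Turing.Tape.mk₁ (L x)).nth j) ⊆ F := by
  simp only [Turing.Tape.mk₁, Turing.Tape.mk₂, tape_mk'_nil_nth, Turing.ListBlank.nth_mk]
  split_ifs
  · exact h.2 _
  · exact oneHot_const_subset hF _

end KnownList

/-- The initial configurations are known when the symbols on the tapes are. -/
theorem knownConfig_init_subset {Δ c n a b k m : ℕ} (M : NodeMachine Δ) (N : Network Δ c n)
    (y : (α → Bool) → Labeling n a b) (rpub : (α → Bool) → Bits k) (rsec : Fin n → Bits m)
    (W : ℕ) {F : Set ((α → Bool) → Prop)} (hF : ∀ p : Prop, (fun _ => p) ∈ F)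
    (hnode : ∀ v i, (oneHot fun x => Sym.bit (encodeLabel ((y x).node v) i)) ⊆ F)
    (hhalf : ∀ v u i, (oneHot fun x => Sym.bit (encodeLabel ((y x).half v u) i)) ⊆ F)
    (hpub : ∀ i, (oneHot fun x => Sym.bit (rpub x i)) ⊆ F) :
    knownConfig W (fun x v => M.init N (y x) (rpub x) rsec v) ⊆ F := by
  refine knownConfig_subset (fun v => oneHot_const_subset hF M.start) fun v t j _ => ?_
  have hblank : (oneHot fun _ : α → Bool => blankTape.nth j) ⊆ F := oneHot_const_subset hF _
  cases t with
  | input =>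
    refine KnownList.tape hF (L := fun x => inputWord N (y x) v) ?_ j
    refine KnownList.append (.append (.append (.const hF _) (.cons hF _ (.const hF _)))
      (.cons hF _ (.ofFn hF (hnode v)))) (.flatMap hF _ fun u => .cons hF _ (.ofFn hF (hhalf v u)))
  | priv => exact oneHot_const_subset hF ((bitTape (List.ofFn (rsec v))).nth j)
  | pub => exact KnownList.tape hF (.ofFn hF hpub) j
  | work => exact hblank
  | out => exact hblank
  | send p => exact hblank
  | recv p => exact hblank

theorem Derives.iUnion_fin {F : Set ((α → Bool) → Prop)} {n m : ℕ}
    {G : Fin n → Set ((α → Bool) → Prop)} (h : ∀ i, Derives F m (G i)) :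
    Derives F (n * m) (⋃ i, G i) := by
  have := Derives.iUnion h
  rwa [Fintype.card_fin] at this

/-- The predicates that describe a labeling. -/
def knownLabeling {n a b : ℕ} (y : (α → Bool) → Labeling n a b) : Set ((α → Bool) → Prop) :=
  (⋃ v, oneHot fun x => (y x).node v) ∪ ⋃ v, ⋃ u, oneHot fun x => (y x).half v u

theorem oneHot_node_subset {n a b : ℕ} (y : (α → Bool) → Labeling n a b) (v : Fin n) :
    (oneHot fun x => (y x).node v) ⊆ knownLabeling y :=
  (Set.subset_iUnion (fun v => oneHot fun x => (y x).node v) v).trans Set.subset_union_left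

theorem oneHot_half_subset {n a b : ℕ} (y : (α → Bool) → Labeling n a b) (v u : Fin n) :
    (oneHot fun x => (y x).half v u) ⊆ knownLabeling y :=
  fun P hP => Or.inr (by simp only [Set.mem_iUnion]; exact ⟨v, u, hP⟩)

theorem Derives.knownLabeling {n a b l l' : ℕ} {y : (α → Bool) → Labeling n a b}
    {F : Set ((α → Bool) → Prop)} (h : ∀ v, Derives F l (oneHot fun x => (y x).node v))
    (h' : ∀ v u, Derives F l' (oneHot fun x => (y x).half v u)) :
    Derives F (n * l + n * (n * l')) (knownLabeling y) :=
  (Derives.iUnion_fin h).union (Derives.iUnion_fin fun v => Derives.iUnion_fin (h' v))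

theorem Derives.oneHot_map_pi {F : Set ((α → Bool) → Prop)} {Γ Γ' : Type*} [Fintype Γ]
    [Fintype Γ'] {k : ℕ} {f : Fin k → (α → Bool) → Γ} (hf : ∀ i, oneHot (f i) ⊆ F)
    (h : (Fin k → Γ) → Γ') :
    Derives F (Fintype.card (Fin k → Γ) * (k + 1) +
      Fintype.card Γ' * (Fintype.card (Fin k → Γ) + 1)) (oneHot fun x => h fun i => f i x) := by
  have := (Derives.oneHot_pi hf).trans (Derives.oneHot_map le_rfl h)
  rwa [Fintype.card_fin k] at this

/-- Decoding the labels of the instance. -/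
theorem exists_decodeInput_cost (Ψ : LCL) :
    ∃ a, ∀ {α : Type} {n : ℕ} (y : (α → Bool) → Ψ.InputWire n → Bool),
      Derives (knownBits y) (n * a + n * (n * a)) (knownLabeling fun x => Ψ.decodeInput (y x)) := by
  refine ⟨max _ _, fun {α n} y => Derives.knownLabeling
    (fun v => (Derives.oneHot_map_pi (fun i => oneHot_bit_subset y (Sum.inl (v, i)))
      (decodeLabel Ψ.nodeIn_pos)).mono_cost (le_max_left _ _))
    (fun v u => (Derives.oneHot_map_pi (fun i => oneHot_bit_subset y (Sum.inr (v, u, i)))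
      (decodeLabel Ψ.halfIn_pos)).mono_cost (le_max_right _ _))⟩

/-- The cost of checking a labeled neighbourhood of `o` nodes under a given isomorphism. -/
def isoCost (o : ℕ) : ℕ :=
  1 + ((o * (0 + 0 + 1) + (o + 1)) +
    (o * (o * (0 + 0 + 1) + (o + 1)) + (o + 1)) + 1) + 1

/-- Composition with the inverse of one fixed isomorphism embeds the isomorphisms into the
permutations of `V`. The bound does not involve `H`, so trying all identifications of a permitted
ball with a neighbourhood has constant cost. -/
theorem card_iso_le {V W : Type*} [Finite V] (G : SimpleGraph V) (H : SimpleGraph W) :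
    Nat.card (G ≃g H) ≤ (Nat.card V).factorial := by
  classical
  obtain hE | ⟨⟨e₀⟩⟩ := isEmpty_or_nonempty (G ≃g H)
  · simp
  · rw [← Nat.card_perm]
    refine Nat.card_le_card_of_injective (fun e : G ≃g H => e.toEquiv.trans e₀.toEquiv.symm) ?_
    intro e e' h
    ext v
    have := congrArg (fun σ : Equiv.Perm V => e₀ (σ v)) h
    simpa using this

/-- Checking the labeling around one node against one permitted ball. -/
theorem derives_matches (Ψ : LCL) {n : ℕ} (G : SimpleGraph (Fin n)) (X : (α → Bool) → Ψ.Input n)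
    (Y : (α → Bool) → Ψ.Output n) (v : Fin n)
    (B : LabeledBall Ψ.nodeIn Ψ.halfIn Ψ.nodeOut Ψ.halfOut) :
    Derives (knownLabeling X ∪ knownLabeling Y)
      (B.order.factorial * isoCost B.order + (B.order.factorial + 1))
      {fun x => Ψ.Matches G (X x) (Y x) v B} := by
  have hX : ∀ Q ∈ knownLabeling X, Derives (knownLabeling X ∪ knownLabeling Y) 0 {Q} :=
    fun Q hQ => Derives.of_subset (by rintro _ rfl; exact Or.inl hQ)
  have hY : ∀ Q ∈ knownLabeling Y, Derives (knownLabeling X ∪ knownLabeling Y) 0 {Q} :=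
    fun Q hQ => Derives.of_subset (by rintro _ rfl; exact Or.inr hQ)
  have hiso : ∀ e : B.graph ≃g G.induce {u : Fin n | G.edist v u ≤ Ψ.radius},
      Derives (knownLabeling X ∪ knownLabeling Y) (isoCost B.order) {fun x =>
        (e B.center : Fin n) = v ∧
        (∀ w, B.inp.node w = (X x).node (e w) ∧ B.outp.node w = (Y x).node (e w)) ∧
        (∀ w w', B.graph.Adj w w' →
          B.inp.half w w' = (X x).half (e w) (e w') ∧
          B.outp.half w w' = (Y x).half (e w) (e w'))} := by
    intro e
    refine (Derives.const _).and_of (Derives.and_of ?_ ?_)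
    · have := Derives.forall_of fun w => Derives.and_of
        (hX _ (oneHot_node_subset X (e w) (mem_oneHot _ (B.inp.node w))))
        (hY _ (oneHot_node_subset Y (e w) (mem_oneHot _ (B.outp.node w))))
      simpa only [Fintype.card_fin, eq_comm] using this
    · have : ∀ w w', Derives (knownLabeling X ∪ knownLabeling Y) (0 + 0 + 1)
          {fun x => B.graph.Adj w w' → B.inp.half w w' = (X x).half (e w) (e w') ∧
            B.outp.half w w' = (Y x).half (e w) (e w')} := by
        intro w w'
        by_cases hadj : B.graph.Adj w w'
        · have := Derives.and_of
            (hX _ (oneHot_half_subset X (e w) (e w') (mem_oneHot _ (B.inp.half w w'))))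
            (hY _ (oneHot_half_subset Y (e w) (e w') (mem_oneHot _ (B.outp.half w w'))))
          simpa only [hadj, true_imp_iff, eq_comm] using this
        · simpa only [hadj, false_imp_iff] using Derives.const True
      simpa only [Fintype.card_fin] using Derives.forall_of fun w => Derives.forall_of (this w)
  have hfin : Finite (B.graph ≃g G.induce {u : Fin n | G.edist v u ≤ Ψ.radius}) :=
    Finite.of_injective (fun e => (e : Fin B.order → _)) DFunLike.coe_injective
  have := Fintype.ofFinite (B.graph ≃g G.induce {u : Fin n | G.edist v u ≤ Ψ.radius})
  have hcard := card_iso_le B.graph (G.induce {u : Fin n | G.edist v u ≤ Ψ.radius})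
  rw [Nat.card_eq_fintype_card, Nat.card_eq_fintype_card, Fintype.card_fin] at hcard
  refine (Derives.exists_of hiso).mono_cost ?_
  gcongr

/-- Checking an output labeling. -/
theorem exists_isSolution_cost (Ψ : LCL) :
    ∃ a, ∀ {α : Type} {n : ℕ} (G : SimpleGraph (Fin n)) (X : (α → Bool) → Ψ.Input n)
      (Y : (α → Bool) → Ψ.Output n), Derives (knownLabeling X ∪ knownLabeling Y)
        (n * a + (n + 1)) {fun x => Ψ.IsSolution G (X x) (Y x)} := by
  let b := Ψ.constraints.sup fun B =>
    B.order.factorial * isoCost B.order + (B.order.factorial + 1)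
  refine ⟨Fintype.card Ψ.constraints * b + (Fintype.card Ψ.constraints + 1),
    fun {α n} G X Y => ?_⟩
  have := Derives.forall_of fun v : Fin n => Derives.exists_of fun B : Ψ.constraints =>
    (derives_matches Ψ G X Y v B).mono_cost (Finset.le_sup (f := fun B :
      LabeledBall Ψ.nodeIn Ψ.halfIn Ψ.nodeOut Ψ.halfOut =>
      B.order.factorial * isoCost B.order + (B.order.factorial + 1)) B.2)
  simp only [Fintype.card_fin, Subtype.exists, exists_prop] at this
  exact this

/-- The validity of the output of a LOCAL algorithm on a fixed network with fixed private coins, as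
a function of the public coins and of the code of the input labeling, has circuits of polynomial
size. -/
theorem exists_isValid_cost {Ψ : LCL} {c : ℕ} {r : ℕ → ℕ} (A : LocalAlgorithm Ψ c r) :
    ∃ q : Polynomial ℕ, ∀ {α : Type} {n : ℕ} (N : Network Ψ.maxDeg c n)
      (y : (α → Bool) → Ψ.InputWire n → Bool) (rpub : (α → Bool) → Bits (A.pubLen n))
      (rsec : Fin n → Bits (A.privLen n)),
      Derives (knownBits y ∪ knownBits rpub) (q.eval n)
        {fun x => A.IsValid N (Ψ.decodeInput (y x)) (rpub x) rsec} := by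
  obtain ⟨a₁, h₁⟩ := exists_decodeInput_cost Ψ
  obtain ⟨a₂, h₂⟩ := exists_exec_cost A.machine
  obtain ⟨a₃, h₃⟩ := exists_isSolution_cost Ψ
  -- The stretch of the output tape that `run` reads. The summand `1` is for non-neighbours `u`,
  -- whose `idxOf` is the length of the port list and may equal `maxDeg`.
  let W := Nat.size Ψ.nodeOut + (Ψ.maxDeg + 1) * Nat.size Ψ.halfOut
  let d₁ := Fintype.card Sym * (Fintype.card (Fin Ψ.nodeIn) + 1)
  let d₂ := Fintype.card Sym * (Fintype.card (Fin Ψ.halfIn) + 1)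
  let d₃ := Fintype.card Sym * (Fintype.card Bool + 1)
  let e₁ := Fintype.card (Fin (Nat.size Ψ.nodeOut) → Sym) * (Nat.size Ψ.nodeOut + 1) +
    Fintype.card (Fin Ψ.nodeOut) * (Fintype.card (Fin (Nat.size Ψ.nodeOut) → Sym) + 1)
  let e₂ := Fintype.card (Fin (Nat.size Ψ.halfOut) → Sym) * (Nat.size Ψ.halfOut + 1) +
    Fintype.card (Fin Ψ.halfOut) * (Fintype.card (Fin (Nat.size Ψ.halfOut) → Sym) + 1)
  let T : ℕ → ℕ := fun n => A.time.eval n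
  let cost : ℕ → ℕ := fun n =>
    (n * a₁ + n * (n * a₁)) +
    ((1 + 1 + n * (Nat.size Ψ.nodeIn * d₁) + n * (n * (Nat.size Ψ.halfIn * d₂)) +
        A.pubLen n * d₃) +
      (((T n + 1 + 1) * (T n + 1) * (a₂ * n * (2 * (W + (T n + 1 + 1) * T n) + 1))) +
        ((n * e₁ + n * (n * e₂)) + (n * a₃ + (n + 1)))))
  have hpub : PolyBounded A.pubLen := A.pubLen_poly
  have hT : PolyBounded T := .eval A.time
  obtain ⟨q, hq⟩ : PolyBounded cost := by
    have id := PolyBounded.id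
    have k := PolyBounded.const
    exact ((id.mul (k _)).add (id.mul (id.mul (k _)))).add
      ((((((k _).add (k _)).add (id.mul (k _))).add (id.mul (id.mul (k _)))).add
        (hpub.mul (k _))).add
        (((((hT.add (k _)).add (k _)).mul (hT.add (k _))).mul (((k _).mul id).mul
          (((k _).mul ((k _).add (((hT.add (k _)).add (k _)).mul hT))).add (k _)))).add
          (((id.mul (k _)).add (id.mul (id.mul (k _)))).add ((id.mul (k _)).add (id.add (k _))))))
  refine ⟨q, fun {α n} N y rpub rsec => Derives.mono_cost ?_ (hq n)⟩
  set X : (α → Bool) → Ψ.Input n := fun x => Ψ.decodeInput (y x) with hX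
  -- the labels
  refine ((h₁ y).mono_left (F' := knownBits y ∪ knownBits rpub)
    Set.subset_union_left).trans_union ?_
  change Derives (_ ∪ knownLabeling X) _ _
  set F₁ := knownBits y ∪ knownBits rpub ∪ knownLabeling X with hF₁
  -- the symbols on the tapes
  have hsym : Derives F₁ (1 + 1 + n * (Nat.size Ψ.nodeIn * d₁) +
      n * (n * (Nat.size Ψ.halfIn * d₂)) + A.pubLen n * d₃)
      ({fun _ => True} ∪ {fun _ => False} ∪
        (⋃ v, ⋃ i, oneHot fun x => Sym.bit (encodeLabel ((X x).node v) i)) ∪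
        (⋃ v, ⋃ u, ⋃ i, oneHot fun x => Sym.bit (encodeLabel ((X x).half v u) i)) ∪
        ⋃ i, oneHot fun x => Sym.bit (rpub x i)) := by
    refine ((((Derives.const True).union (Derives.const False)).union ?_).union ?_).union ?_
    · exact Derives.iUnion_fin fun v : Fin n => Derives.iUnion_fin
        fun i : Fin (Nat.size Ψ.nodeIn) => Derives.oneHot_map (F := F₁)
          (Set.subset_union_of_subset_right (oneHot_node_subset X v) _)
          fun l => Sym.bit (encodeLabel l i)
    · exact Derives.iUnion_fin fun v : Fin n => Derives.iUnion_fin fun u : Fin n => Derives.iUnion_fin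
        fun i : Fin (Nat.size Ψ.halfIn) => Derives.oneHot_map (F := F₁)
          (Set.subset_union_of_subset_right (oneHot_half_subset X v u) _)
          fun l => Sym.bit (encodeLabel l i)
    · exact Derives.iUnion_fin fun i : Fin (A.pubLen n) => Derives.oneHot_map (F := F₁)
        (Set.subset_union_of_subset_left
          (Set.subset_union_of_subset_right (oneHot_bit_subset rpub i) _) _) Sym.bit
  refine hsym.trans_union ?_
  set F₂ := ({fun _ => True} ∪ {fun _ => False} ∪
        (⋃ v, ⋃ i, oneHot fun x => Sym.bit (encodeLabel ((X x).node v) i)) ∪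
        (⋃ v, ⋃ u, ⋃ i, oneHot fun x => Sym.bit (encodeLabel ((X x).half v u) i)) ∪
        ⋃ i, oneHot fun x => Sym.bit (rpub x i) : Set ((α → Bool) → Prop)) with hF₂
  have hconst : ∀ p : Prop, (fun _ => p) ∈ F₁ ∪ F₂ := by
    intro p
    refine Or.inr (Or.inl (Or.inl (Or.inl ?_)))
    by_cases hp : p
    · exact Or.inl (by simp [hp])
    · exact Or.inr (by simp [hp])
  have hinit : ∀ W', knownConfig W'
      (fun x v => A.machine.init N (X x) (rpub x) rsec v) ⊆ F₁ ∪ F₂ := by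
    refine fun W' => knownConfig_init_subset _ N X rpub rsec W' hconst ?_ ?_ ?_
    · exact fun v i P hP => Or.inr (Or.inl (Or.inl (Or.inr (by
        simp only [Set.mem_iUnion]; exact ⟨v, i, hP⟩))))
    · exact fun v u i P hP => Or.inr (Or.inl (Or.inr (by
        simp only [Set.mem_iUnion]; exact ⟨v, u, i, hP⟩)))
    · exact fun i P hP => Or.inr (Or.inr (by simp only [Set.mem_iUnion]; exact ⟨i, hP⟩))
  -- the execution
  set i₀ := min (r n) (T n + 1) with hi₀
  have hexec := ((h₂ N W (T n) i₀ X rpub rsec).mono_left (hinit _)).mono_cost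
    (m' := (T n + 1 + 1) * (T n + 1) * (a₂ * n * (2 * (W + (T n + 1 + 1) * T n) + 1))) (by
      have : i₀ ≤ T n + 1 := min_le_right _ _
      gcongr)
  refine hexec.trans_union ?_
  set F₃ := knownConfig W fun x v => A.machine.exec N (X x) (rpub x) rsec (T n) i₀ v
  have hcell : ∀ (v : Fin n) (j : ℕ), j < W → (oneHot fun x =>
      ((A.machine.exec N (X x) (rpub x) rsec (A.time.eval n) (r n) v).tape .out).nth j) ⊆
      F₁ ∪ F₂ ∪ F₃ := by
    intro v j hj
    refine Set.subset_union_of_subset_right ?_ _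
    have hW : (j : ℤ) ∈ Finset.Icc (-(W : ℤ)) W := by
      rw [Finset.mem_Icc]
      omega
    convert oneHot_cell_subset (fun x v => A.machine.exec N (X x) (rpub x) rsec (T n) i₀ v) v
      .out hW using 4 with x
    exact exec_out_eq N (X x) (rpub x) rsec (A.time.eval n) (A.halts n N (X x) (rpub x) rsec v).2
  -- the output labels
  have hrun : Derives (F₁ ∪ F₂ ∪ F₃) (n * e₁ + n * (n * e₂))
      (knownLabeling fun x => A.run N (X x) (rpub x) rsec) := by
    refine Derives.knownLabeling (fun v => ?_) fun v u => ?_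
    · exact Derives.oneHot_map_pi (fun i : Fin (Nat.size Ψ.nodeOut) => hcell v i (by
        have := i.2
        simp only [W]
        omega)) fun s => decodeLabel Ψ.nodeOut_pos fun i => decide (s i = Sym.bit true)
    · refine Derives.oneHot_map_pi (fun i : Fin (Nat.size Ψ.halfOut) => hcell v
        (Nat.size Ψ.nodeOut + (N.ports v).idxOf u * Nat.size Ψ.halfOut + i) ?_)
        fun s => decodeLabel Ψ.halfOut_pos fun i => decide (s i = Sym.bit true)
      have h1 : (N.ports v).idxOf u ≤ Ψ.maxDeg := List.idxOf_le_length.trans (N.degree_le v)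
      have h2 := Nat.mul_le_mul_right (Nat.size Ψ.halfOut) h1
      have h3 := i.2
      simp only [W, add_mul, one_mul]
      omega
  refine hrun.trans_union ((h₃ N.graph X fun x => A.run N (X x) (rpub x) rsec).mono_left ?_)
  exact Set.union_subset_union_left _ (Set.subset_union_of_subset_left
    (Set.subset_union_of_subset_left Set.subset_union_right _) _)

end Validity

/-! ### Finite probability -/

section Probability

variable {Ω Ω' : Type} [Fintype Ω] [Fintype Ω']

theorem prob_eq (P : Ω → Prop) [DecidablePred P] :
    prob P = ((Finset.univ.filter P).card : ℝ) / (Fintype.card Ω : ℝ) := by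
  unfold prob
  congr!

theorem prob_nonneg (P : Ω → Prop) : 0 ≤ prob P := by
  unfold prob
  positivity

theorem prob_le_one (P : Ω → Prop) : prob P ≤ 1 := by
  classical
  unfold prob
  refine div_le_one_of_le₀ ?_ (by positivity)
  exact_mod_cast Finset.card_le_univ _

theorem prob_mono {P Q : Ω → Prop} (h : ∀ ω, P ω → Q ω) : prob P ≤ prob Q := by
  classical
  simp only [prob_eq]
  gcongr with ω
  exact h ω

theorem prob_or_le (P Q : Ω → Prop) : prob (fun ω => P ω ∨ Q ω) ≤ prob P + prob Q := by
  classical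
  simp only [prob_eq]
  rw [← add_div, Finset.filter_or]
  gcongr
  exact_mod_cast Finset.card_union_le _ _

theorem prob_exists_le {ι : Type*} [Fintype ι] (P : ι → Ω → Prop) :
    prob (fun ω => ∃ i, P i ω) ≤ ∑ i, prob (P i) := by
  classical
  simp only [prob_eq]
  rw [← Finset.sum_div]
  gcongr
  have : (Finset.univ.filter fun ω => ∃ i, P i ω) =
      Finset.univ.biUnion fun i => Finset.univ.filter (P i) := by
    ext ω
    simp
  rw [this]
  exact_mod_cast Finset.card_biUnion_le

theorem prob_not [Nonempty Ω] (P : Ω → Prop) : prob (fun ω => ¬ P ω) = 1 - prob P := by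
  classical
  simp only [prob_eq]
  have h := Finset.card_filter_add_card_filter_not (s := (Finset.univ : Finset Ω)) P
  rw [eq_sub_iff_add_eq', ← add_div, div_eq_one_iff_eq (by simp), ← Finset.card_univ, ← h]
  push_cast
  rfl

theorem exists_not_of_prob_lt_one [Nonempty Ω] {P : Ω → Prop} (h : prob P < 1) : ∃ ω, ¬ P ω := by
  by_contra! hP
  have := prob_not P
  have h0 : prob (fun ω => ¬ P ω) = 0 := by simp [prob, hP]
  linarith

theorem prob_equiv (e : Ω ≃ Ω') (P : Ω' → Prop) : prob (fun ω => P (e ω)) = prob P := by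
  classical
  simp only [prob_eq]
  rw [Fintype.card_congr e]
  congr 2
  refine Finset.card_bij (fun ω _ => e ω) (by simp) (fun a _ b _ h => e.injective h) fun b hb => ?_
  exact ⟨e.symm b, by simpa using hb, by simp⟩

theorem prob_pi (k : ℕ) (P : Ω → Prop) : prob (fun R : Fin k → Ω => ∀ i, P (R i)) = prob P ^ k := by
  classical
  simp only [prob_eq]
  have : (Finset.univ.filter fun R : Fin k → Ω => ∀ i, P (R i)) =
      Fintype.piFinset fun _ => Finset.univ.filter P := by
    ext R
    simp
  rw [this, Fintype.card_piFinset_const, Fintype.card_fun, Fintype.card_fin, div_pow]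
  push_cast
  rfl

theorem prob_prod (P : Ω × Ω' → Prop) :
    prob P = (∑ a, prob fun b => P (a, b)) / Fintype.card Ω := by
  classical
  simp only [prob_eq]
  rw [← Finset.sum_div, div_div, Fintype.card_prod, ← Nat.cast_sum]
  congr 2
  · rw [Finset.card_filter, Fintype.sum_prod_type]
    simp only [Finset.card_filter]
  · push_cast
    ring

theorem prob_swap (P : Ω × Ω' → Prop) : prob P = prob fun ω : Ω' × Ω => P (ω.2, ω.1) :=
  (prob_equiv (Equiv.prodComm Ω' Ω) P).symm

/-- Averaging: the second component can be fixed without decreasing the probability. -/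
theorem exists_prob_le [Nonempty Ω'] (P : Ω × Ω' → Prop) :
    ∃ b, prob P ≤ prob fun a => P (a, b) := by
  by_contra! h
  have hlt : ∑ b, prob (fun a => P (a, b)) < ∑ _b : Ω', prob P :=
    Finset.sum_lt_sum_of_nonempty Finset.univ_nonempty fun b _ => h b
  have h2 := prob_swap P
  rw [prob_prod (Ω := Ω')] at h2
  have hc : (0 : ℝ) < Fintype.card Ω' := by exact_mod_cast Fintype.card_pos
  rw [Finset.sum_const, Finset.card_univ, nsmul_eq_mul] at hlt
  rw [eq_div_iff hc.ne'] at h2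
  linarith

/-- The average over the first factor is bounded below by the contribution of `Q`. -/
theorem mul_le_prob_prod {P : Ω × Ω' → Prop} {Q : Ω → Prop} {δ : ℝ}
    (h : ∀ a, Q a → δ ≤ prob fun b => P (a, b)) : prob Q * δ ≤ prob P := by
  classical
  rw [prob_prod]
  simp only [prob_eq Q]
  rw [div_mul_eq_mul_div]
  gcongr
  calc ((Finset.univ.filter Q).card : ℝ) * δ = ∑ a ∈ Finset.univ.filter Q, δ := by simp
    _ ≤ ∑ a ∈ Finset.univ.filter Q, prob (fun b => P (a, b)) :=
        Finset.sum_le_sum fun a ha => h a (Finset.mem_filter.1 ha).2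
    _ ≤ ∑ a, prob (fun b => P (a, b)) :=
        Finset.sum_le_sum_of_subset_of_nonneg (Finset.subset_univ _) fun a _ _ => prob_nonneg _

/-- A probability of `φ` over a product is due to a part of measure `φ / 2` of the first factor. -/
theorem half_le_prob [Nonempty Ω] {P : Ω × Ω' → Prop} {φ : ℝ} (hφ : 0 ≤ φ) (h : φ ≤ prob P) :
    φ / 2 ≤ prob fun a => φ / 2 ≤ prob fun b => P (a, b) := by
  classical
  have hc : (0 : ℝ) < Fintype.card Ω := by exact_mod_cast Fintype.card_pos
  rw [prob_prod] at h
  set Q : Ω → Prop := fun a => φ / 2 ≤ prob fun b => P (a, b) with hQ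
  -- Slices in `Q` contribute at most `1` and the others less than `φ / 2`.
  have h1 : ∑ a, prob (fun b => P (a, b)) ≤ ∑ a, ((if Q a then 1 else 0) + φ / 2) := by
    refine Finset.sum_le_sum fun a _ => ?_
    split_ifs with ha
    · have := prob_le_one fun b => P (a, b)
      linarith
    · have : prob (fun b => P (a, b)) < φ / 2 := not_le.1 ha
      linarith
  rw [Finset.sum_add_distrib, Finset.sum_const, Finset.card_univ, nsmul_eq_mul,
    ← Finset.sum_filter, Finset.sum_const, nsmul_eq_mul, mul_one] at h1
  rw [prob_eq, le_div_iff₀ hc]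
  rw [le_div_iff₀ hc] at h
  linarith

/-- From `1 - η ≤ exp (-η)` and `2 ≤ exp 1`; `η ≤ 1` makes the base nonnegative. -/
theorem one_sub_pow_le {η : ℝ} {m j : ℕ} (h1 : η ≤ 1) (h : (j : ℝ) ≤ m * η) :
    (1 - η) ^ m ≤ (1 / 2) ^ j := by
  have h2 : (2 : ℝ) ≤ Real.exp 1 := by
    have := Real.add_one_le_exp (1 : ℝ)
    linarith
  calc (1 - η) ^ m ≤ Real.exp (-η) ^ m := by
        exact pow_le_pow_left₀ (by linarith) (Real.one_sub_le_exp_neg η) m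
    _ = Real.exp (-(m * η)) := by rw [← Real.exp_nat_mul]; ring_nf
    _ ≤ Real.exp (-(j : ℝ)) := Real.exp_le_exp.2 (by linarith)
    _ = (1 / Real.exp 1) ^ j := by
        rw [Real.exp_neg, one_div, inv_pow, ← Real.exp_nat_mul, mul_one]
    _ ≤ (1 / 2) ^ j := by gcongr

/-- Derandomization: there are samples that distinguish the events of probability at least `δ` from
those of probability at most `1 / (2 s)`. -/
theorem exists_samples [Nonempty Ω] {Q : Type} [Fintype Q] (E : Q → Ω → Prop) {a s : ℕ}
    (hQ : Fintype.card Q ≤ 2 ^ a) {δ : ℝ} (hs : ((a + (a + 2) : ℕ) : ℝ) ≤ s * δ) :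
    ∃ R : Fin (a + 2) → Fin s → Ω, ∀ q, (δ ≤ prob (E q) → ∀ i, ∃ j, E q (R i j)) ∧
      ((∀ i, ∃ j, E q (R i j)) → 1 / (2 * s) < prob (E q)) := by
  -- A conjunction of `a + 2` rows, each a disjunction of `s` samples. The wide rows make a likely
  -- event pass; the number of rows rejects an unlikely one.
  let pass : Q → (Fin (a + 2) → Fin s → Ω) → Prop := fun q R => ∀ i, ∃ j, E q (R i j)
  have hpass : ∀ q, prob (pass q) = (1 - (1 - prob (E q)) ^ s) ^ (a + 2) := by
    intro q
    have h1 := prob_pi (a + 2) fun S : Fin s → Ω => ∃ j, E q (S j)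
    have h2 := prob_not fun S : Fin s → Ω => ∀ j, ¬ E q (S j)
    simp only [not_forall, not_not] at h2
    rw [h2, prob_pi s (fun ω => ¬ E q ω), prob_not] at h1
    exact h1
  let bad : Q → (Fin (a + 2) → Fin s → Ω) → Prop := fun q R =>
    (δ ≤ prob (E q) ∧ ¬ pass q R) ∨ (prob (E q) ≤ 1 / (2 * s) ∧ pass q R)
  have hbad1 : ∀ q, prob (fun R => δ ≤ prob (E q) ∧ ¬ pass q R) ≤
      ((a + 2 : ℕ) : ℝ) * (1 / 2) ^ (a + (a + 2)) := by
    intro q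
    by_cases hq : δ ≤ prob (E q)
    · simp only [hq, true_and]
      rw [prob_not, hpass]
      set t := (1 - prob (E q)) ^ s
      have ht0 : 0 ≤ t := pow_nonneg (by linarith [prob_le_one (E q)]) _
      have ht1 : t ≤ 1 := pow_le_one₀ (by linarith [prob_le_one (E q)])
        (by linarith [prob_nonneg (E q)])
      have ht : t ≤ (1 / 2) ^ (a + (a + 2)) := one_sub_pow_le (prob_le_one _)
        (hs.trans (by gcongr))
      -- Bernoulli's inequality serves as the union bound over the rows: a row has no hit with
      -- probability `t`.
      have hb := one_add_mul_le_pow (a := -t) (by linarith) (a + 2)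
      have : ((a + 2 : ℕ) : ℝ) * t ≤ ((a + 2 : ℕ) : ℝ) * (1 / 2) ^ (a + (a + 2)) := by gcongr
      rw [← sub_eq_add_neg] at hb
      linarith
    · simp only [hq, false_and]
      have : prob (fun _ : Fin (a + 2) → Fin s → Ω => False) = 0 := by simp [prob]
      rw [this]
      positivity
  have hbad2 : ∀ q, prob (fun R => prob (E q) ≤ 1 / (2 * s) ∧ pass q R) ≤
      (1 / 2) ^ (a + 2) := by
    intro q
    by_cases hq : prob (E q) ≤ 1 / (2 * s)
    · simp only [hq, true_and]
      rw [hpass]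
      have hp1 := prob_le_one (E q)
      have hp0 := prob_nonneg (E q)
      refine pow_le_pow_left₀ ?_ ?_ _
      · have := pow_le_one₀ (n := s) (a := 1 - prob (E q)) (by linarith) (by linarith)
        linarith
      -- Again Bernoulli: a single row has a hit with probability at most `s * prob (E q) ≤ 1 / 2`.
      · have hb := one_add_mul_le_pow (a := -prob (E q)) (by linarith) s
        rw [← sub_eq_add_neg] at hb
        have : (s : ℝ) * prob (E q) ≤ 1 / 2 := by
          obtain rfl | hs0 := s.eq_zero_or_pos
          · norm_num
          · have hs0' : (0 : ℝ) < s := by exact_mod_cast hs0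
            calc (s : ℝ) * prob (E q) ≤ s * (1 / (2 * s)) := by gcongr
              _ = 1 / 2 := by field_simp
        linarith
    · simp only [hq, false_and]
      have : prob (fun _ : Fin (a + 2) → Fin s → Ω => False) = 0 := by simp [prob]
      rw [this]
      positivity
  -- Over at most `2 ^ a` events the two kinds of error sum to at most `1 / 2 + 1 / 4`.
  have hsum : prob (fun R => ∃ q, bad q R) < 1 := by
    have hcard : (Fintype.card Q : ℝ) ≤ 2 ^ a := by exact_mod_cast hQ
    have ha : ((a + 2 : ℕ) : ℝ) ≤ 2 ^ (a + 1) := by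
      exact_mod_cast Nat.lt_two_pow_self (n := a + 1)
    calc prob (fun R => ∃ q, bad q R) ≤ ∑ q, prob (bad q) := prob_exists_le _
      _ ≤ ∑ _q : Q, (((a + 2 : ℕ) : ℝ) * (1 / 2) ^ (a + (a + 2)) + (1 / 2) ^ (a + 2)) :=
          Finset.sum_le_sum fun q _ => (prob_or_le _ _).trans (add_le_add (hbad1 q) (hbad2 q))
      _ = Fintype.card Q * (((a + 2 : ℕ) : ℝ) * (1 / 2) ^ (a + (a + 2)) + (1 / 2) ^ (a + 2)) := by
          rw [Finset.sum_const, Finset.card_univ, nsmul_eq_mul]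
      _ ≤ 2 ^ a * (2 ^ (a + 1) * (1 / 2) ^ (a + (a + 2)) + (1 / 2) ^ (a + 2)) := by gcongr
      _ = (2 * (1 / 2)) ^ a * ((2 * (1 / 2)) ^ (a + 1) * (1 / 2) + (1 / 4)) := by
          simp only [mul_pow, pow_add]
          ring
      _ < 1 := by norm_num
  obtain ⟨R, hR⟩ := exists_not_of_prob_lt_one hsum
  refine ⟨R, fun q => ⟨fun hq => ?_, fun hq => ?_⟩⟩
  · by_contra hp
    exact hR ⟨q, Or.inl ⟨hq, hp⟩⟩
  · by_contra hp
    exact hR ⟨q, Or.inr ⟨not_lt.1 hp, hq⟩⟩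

/-- Bitwise exclusive or with a fixed string. -/
def xorEquiv {k : ℕ} (s : Bits k) : Bits k ≃ Bits k where
  toFun x i := xor (x i) (s i)
  invFun x i := xor (x i) (s i)
  left_inv x := by ext i; simp
  right_inv x := by ext i; simp

theorem xorEquiv_comm {k : ℕ} (s x : Bits k) : xorEquiv s x = xorEquiv x s := by
  ext i
  simp [xorEquiv, Bool.xor_comm]

/-- Finitely many translates of a large set cover all bit strings. -/
theorem exists_shifts {k m : ℕ} (P : Bits k → Prop) {η : ℝ} (hP : η ≤ prob P)
    (hm : ((k + 1 : ℕ) : ℝ) ≤ m * η) : ∃ s : Fin m → Bits k, ∀ x, ∃ i, P (xorEquiv (s i) x) := by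
  have hx : ∀ x : Bits k, prob (fun s : Fin m → Bits k => ∀ i, ¬ P (xorEquiv (s i) x)) ≤
      (1 / 2) ^ (k + 1) := by
    intro x
    rw [prob_pi m fun s => ¬ P (xorEquiv s x), prob_not]
    -- For fixed `x` the translate of `x` by a uniform string is itself uniform.
    simp only [xorEquiv_comm _ x]
    rw [prob_equiv (xorEquiv x) P]
    exact one_sub_pow_le (prob_le_one P) (hm.trans (by gcongr))
  have hsum : prob (fun s : Fin m → Bits k => ∃ x, ∀ i, ¬ P (xorEquiv (s i) x)) < 1 := by
    calc prob (fun s : Fin m → Bits k => ∃ x, ∀ i, ¬ P (xorEquiv (s i) x))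
        ≤ ∑ x : Bits k, prob (fun s : Fin m → Bits k => ∀ i, ¬ P (xorEquiv (s i) x)) :=
          prob_exists_le _
      _ ≤ ∑ _x : Bits k, (1 / 2 : ℝ) ^ (k + 1) := Finset.sum_le_sum fun x _ => hx x
      _ = (2 * (1 / 2)) ^ k * (1 / 2) := by
          rw [Finset.sum_const, Finset.card_univ, nsmul_eq_mul, mul_pow, pow_succ]
          simp
      _ < 1 := by norm_num
  obtain ⟨s, hs⟩ := exists_not_of_prob_lt_one hsum
  push Not at hs
  exact ⟨s, hs⟩

end Probability

/-! ### From solvers to adversaries -/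

section Reduction

theorem takeWhile_finRange_getD {l : ℕ} (p f : Fin l → Bool) {j : ℕ}
    (hj : j < (((List.finRange l).takeWhile p).map f).length) (hl : j < l) :
    (((List.finRange l).takeWhile p).map f).getD j false = f ⟨j, hl⟩ := by
  rw [List.getD_eq_getElem _ _ hj, List.getElem_map]
  congr 1
  rw [List.length_map] at hj
  have := (List.takeWhile_prefix p (l := List.finRange l)).getElem hj
  rw [this]
  simp

/-- Pigeonhole through the union bound. It serves to hardwire the translate at which a solver
succeeds most often, at the price of a factor `M`. -/
theorem exists_div_card_le {Ω : Type} [Fintype Ω] {M : ℕ} (hM : 0 < M) {W : Ω → Prop}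
    {P : Fin M → Ω → Prop} (h : ∀ ω, W ω → ∃ i, P i ω) : ∃ i, prob W / M ≤ prob (P i) := by
  by_contra! hlt
  have : Nonempty (Fin M) := ⟨⟨0, hM⟩⟩
  have h1 : ∑ i, prob (P i) < ∑ _i : Fin M, prob W / M :=
    Finset.sum_lt_sum_of_nonempty Finset.univ_nonempty fun i _ => hlt i
  have h2 : prob W ≤ ∑ i, prob (P i) := (prob_mono h).trans (prob_exists_le P)
  have hM' : (0 : ℝ) < M := by exact_mod_cast hM
  rw [Finset.sum_const, Finset.card_univ, Fintype.card_fin, nsmul_eq_mul,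
    mul_div_cancel₀ _ hM'.ne'] at h1
  linarith

/-- A solver that finds, for a prefix `x` of its instance, a string that passes a test at some
translate of `x`, yields a circuit that passes the test at a random point. -/
theorem exists_advantage {k l L M : ℕ} {I : Type} (code : I ≃ Fin L) (hk : k ≤ l) (hM : 0 < M)
    (sh : Fin M → Bits k) (test : Bits k → (I → Bool) → Prop) (sol : Solver l)
    (W : Bits l × Bits sol.prog.coins → Prop)
    (hW : ∀ ω, W ω → (sol.run ω.1 ω.1 ω.2).length = L ∧
      ∃ i, test (xorEquiv (sh i) fun i => (List.ofFn ω.1).getD i false)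
        fun c => (sol.run ω.1 ω.1 ω.2).getD (code c) false) :
    ∃ B : RandCircuit (Fin k) I, B.circuit.size ≤ 1 + 1 + k * 2 + sol.prog.circuit.size ∧
      prob W / M ≤ prob fun ω : Bits B.coins × Bits k => test ω.2 (B.run ω.2 ω.1) := by
  obtain ⟨d, rfl⟩ := Nat.exists_eq_add_of_le hk
  by_cases hL : L ≤ sol.maxLen
  -- A solver whose outputs are too short to be codes never wins, so any circuit will do.
  swap
  · refine ⟨⟨0, [], fun _ => 0⟩, by simp [Circuit.size], ?_⟩
    have hW0 : prob W = 0 := by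
      have : ∀ ω, ¬ W ω := by
        intro ω hω
        have h1 := (hW ω hω).1
        have h2 : (sol.run ω.1 ω.1 ω.2).length ≤ sol.maxLen := by
          simp only [Solver.run, List.length_map]
          exact (List.takeWhile_prefix _).length_le.trans (by simp)
        omega
      simp [prob, this]
    rw [hW0, zero_div]
    exact prob_nonneg _
  let idx : I → Fin sol.maxLen := fun c => ⟨code c, (code c).2.trans_le hL⟩
  let Y : Bits (k + d) → Bits sol.prog.coins → I → Bool := fun x ω c =>
    sol.prog.run (Sum.elim x x) ω (Sum.inl (idx c))
  obtain ⟨i, hi⟩ := exists_div_card_le hM (W := W)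
    (P := fun i ω => test (xorEquiv (sh i) fun j => ω.1 (Fin.castAdd d j)) (Y ω.1 ω.2)) (by
      intro ω hω
      obtain ⟨h1, i, h2⟩ := hW ω hω
      refine ⟨i, ?_⟩
      convert h2 using 2
      · ext j
        rw [List.getD_eq_getElem _ _ (by simp; omega)]
        simp
        rfl
      · rename_i c
        exact (takeWhile_finRange_getD _ _ (by
          change (code c : ℕ) < (sol.run ω.1 ω.1 ω.2).length
          rw [h1]
          exact (code c).2) _).symm)
  -- Change of variables: the translated prefix becomes the public string `r`, and the instance is
  -- the inverse translate of `r` followed by padding.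
  let e : Bits k × (Bits d × Bits sol.prog.coins) ≃ Bits (k + d) × Bits sol.prog.coins :=
    ((xorEquiv (sh i)).prodCongr (Equiv.refl _)).trans
      ((Equiv.prodAssoc _ _ _).symm.trans ((Fin.appendEquiv k d).prodCongr (Equiv.refl _)))
  replace hi := hi.trans_eq (prob_equiv e _).symm
  -- Padding and solver coins are fixed to their best values, so the adversary tosses no coins.
  obtain ⟨⟨b, ω⟩, hb⟩ := exists_prob_le fun ω =>
    test (xorEquiv (sh i) fun j => (e ω).1 (Fin.castAdd d j)) (Y (e ω).1 (e ω).2)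
  have hfst : ∀ r : Bits k, (xorEquiv (sh i) fun j => (e (r, b, ω)).1 (Fin.castAdd d j)) = r := by
    intro r
    ext j
    simp [e, xorEquiv, Fin.appendEquiv]
  let f : (Fin k ⊕ Fin 0 → Bool) → ((Fin (k + d) ⊕ Fin (k + d)) ⊕ Fin sol.prog.coins) → Bool :=
    fun x => Sum.elim (Sum.elim (e (fun j => x (Sum.inl j), b, ω)).1
      (e (fun j => x (Sum.inl j), b, ω)).1) ω
  -- Translation by a fixed string costs an input gate and at most one negation per bit.
  have hbit : ∀ j : Fin k, Derives ∅ 2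
      {fun x : Fin k ⊕ Fin 0 → Bool => (xor (x (Sum.inl j)) (sh i j)) = true} := by
    intro j
    cases sh i j with
    | false => simpa using (Derives.input (F := ∅) (Sum.inl j)).mono_cost (by norm_num)
    | true => simpa using (Derives.input (F := ∅) (Sum.inl j)).not_of
  have hder : Derives ∅ (1 + 1 + k * 2) {P | ∃ b, P = fun x => f x b = true} := by
    have h1 := ((Derives.const (F := (∅ : Set ((Fin k ⊕ Fin 0 → Bool) → Prop))) True).union
      (Derives.const False)).union (Derives.range hbit)
    rw [Fintype.card_fin] at h1
    refine h1.mono_right ?_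
    have hc : ∀ β : Bool, (fun _ : Fin k ⊕ Fin 0 → Bool => β = true) ∈
        ({fun _ => True} ∪ {fun _ => False} : Set ((Fin k ⊕ Fin 0 → Bool) → Prop)) := by
      rintro (_ | _)
      · exact Or.inr (by simp)
      · exact Or.inl (by simp)
    have hx : ∀ j : Fin (k + d), (fun x : Fin k ⊕ Fin 0 → Bool =>
        (e (fun j => x (Sum.inl j), b, ω)).1 j = true) ∈
        ({fun _ => True} ∪ {fun _ => False} ∪ Set.range fun j x =>
          (xor (x (Sum.inl j)) (sh i j)) = true : Set ((Fin k ⊕ Fin 0 → Bool) → Prop)) := by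
      intro j
      refine Fin.addCases (fun j => Or.inr ⟨j, ?_⟩) (fun j => Or.inl ?_) j
      · simp [e, xorEquiv, Fin.appendEquiv]
      · simpa [e, Fin.appendEquiv] using hc (b j)
    rintro _ ⟨(j | j) | j, rfl⟩
    · exact hx j
    · exact hx j
    · exact Or.inl (hc (ω j))
  obtain ⟨C, hC, hCe⟩ := exists_circuit_subst hder sol.prog.circuit fun c : I => Sum.inl (idx c)
  refine ⟨⟨0, C⟩, hC, (hi.trans hb).trans ?_⟩
  rw [prob_prod]
  simp only [Finset.univ_unique, Finset.sum_singleton, Fintype.card_unique, Nat.cast_one, div_one]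
  refine prob_mono fun r hr => ?_
  simp only [hfst] at hr
  convert hr using 1
  ext c
  exact hCe _ _

end Reduction

/-! ### Negligible functions -/

theorem Negligible.poly_mul {f : ℕ → ℝ} (hf : Negligible f) (q : Polynomial ℕ) :
    Negligible fun n => ((q.eval n : ℕ) : ℝ) * f n := by
  have := hf.polynomial_mul (q.map (Nat.castRingHom ℝ))
  refine this.congr fun n => ?_
  simp [Polynomial.eval_natCast_map]

theorem negligible_half_pow : Negligible fun n => (1 / 2 : ℝ) ^ n := fun k =>
  tendsto_pow_const_mul_const_pow_of_abs_lt_one k (by norm_num [abs_of_pos])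

open Classical in
/-- Reindexing along a strictly monotone polynomial. -/
theorem Negligible.reindex {f : ℕ → ℝ} (hf : Negligible f) (P : Polynomial ℕ)
    (hP : StrictMono fun n => P.eval n) (inv : ℕ → ℕ) :
    Negligible fun l => if P.eval (inv l) = l then f (inv l) else 0 := by
  intro k
  -- At `l = P n` the factor `l ^ k` is `(P ^ k) n`, again a polynomial in `n`.
  have h := (hf.poly_mul (P ^ k)) 0
  rw [Metric.tendsto_atTop] at h ⊢
  intro e he
  obtain ⟨N, hN⟩ := h e he
  refine ⟨P.eval N, fun l hl => ?_⟩
  by_cases hl' : P.eval (inv l) = l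
  · have := hN (inv l) (hP.le_iff_le.1 (by simpa only [hl'] using hl))
    simpa [hl'] using this
  · simpa [hl'] using he

/-! ### The search problem -/

section Search

/-- Samples of the private coins that test for failure, and translations that make the search for
a failure total. -/
theorem exists_advice {k a p : ℕ} {Y Ω : Type} [Fintype Y] [Fintype Ω] [Nonempty Ω]
    (E : Bits k → Y → Ω → Prop) (hcard : Fintype.card (Bits k × Y) ≤ 2 ^ a) (hp : 0 < p)
    (B : Bits k → Y)
    (h : 1 / (p : ℝ) ≤ prob fun ω : Bits k × Ω => E ω.1 (B ω.1) ω.2) :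
    ∃ (R : Fin (a + 2) → Fin ((a + (a + 2)) * (2 * p)) → Ω)
      (sh : Fin ((k + 1) * (2 * p)) → Bits k),
      (∀ x, ∃ y i, ∀ g, ∃ j, E (xorEquiv (sh i) x) y (R g j)) ∧
      ∀ r y, (∀ g, ∃ j, E r y (R g j)) →
        1 / (2 * (((a + (a + 2)) * (2 * p) : ℕ) : ℝ)) < prob (E r y) := by
  have hp' : (0 : ℝ) < p := by exact_mod_cast hp
  have hhalf := half_le_prob (by positivity) h
  -- With `δ = 1 / (2p)` the row length gives exactly `s * δ = a + (a + 2)`; the number of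
  -- translates below is chosen in the same way.
  obtain ⟨R, hR⟩ := exists_samples (fun q : Bits k × Y => E q.1 q.2) hcard
    (s := (a + (a + 2)) * (2 * p)) (δ := 1 / (p : ℝ) / 2) (by
      push_cast
      field_simp
      rfl)
  obtain ⟨sh, hsh⟩ := exists_shifts (m := (k + 1) * (2 * p)) _ hhalf (by
    push_cast
    field_simp
    rfl)
  refine ⟨R, sh, fun x => ?_, fun r y hry => (hR (r, y)).2 hry⟩
  obtain ⟨i, hi⟩ := hsh x
  -- The unbounded adversary's answer at the good translate is the solution.
  exact ⟨B (xorEquiv (sh i) x), i, (hR (xorEquiv (sh i) x, B (xorEquiv (sh i) x))).1 hi⟩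

variable {Ψ : LCL} {c : ℕ} {r : ℕ → ℕ}

/-- The algorithm fails on the input labeling with code `y` and some translate of `x` as public
coins, in each row of the samples `R` of the private coins. -/
def FailsOn (A : LocalAlgorithm Ψ c r) {n g s M : ℕ} (N : Network Ψ.maxDeg c n)
    (R : Fin g → Fin s → Fin n → Bits (A.privLen n)) (sh : Fin M → Bits (A.pubLen n))
    (x : Bits (A.pubLen n)) (y : Ψ.InputWire n → Bool) : Prop :=
  ∃ i, ∀ a, ∃ b, ¬ A.IsValid N (Ψ.decodeInput y) (xorEquiv (sh i) x) (R a b)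

/-- The circuit tries all `M` translates and all `g * s` samples. The `6` is the cost of a map from
`Bool` to `Bool` in one-hot form. -/
theorem exists_failsOn_cost (A : LocalAlgorithm Ψ c r) :
    ∃ q : Polynomial ℕ, ∀ {α : Type} {n g s M : ℕ} (N : Network Ψ.maxDeg c n)
      (R : Fin g → Fin s → Fin n → Bits (A.privLen n)) (sh : Fin M → Bits (A.pubLen n))
      (x : (α → Bool) → Bits (A.pubLen n)) (y : (α → Bool) → Ψ.InputWire n → Bool),
      Derives (knownBits y ∪ knownBits x)
        (M * (A.pubLen n * 6 + (g * (s * (q.eval n + 1) + (s + 1)) + (g + 1))) + (M + 1))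
        {fun z => FailsOn A N R sh (x z) (y z)} := by
  obtain ⟨q, hq⟩ := exists_isValid_cost A
  refine ⟨q, fun {α n g s M} N R sh x y => ?_⟩
  have hshift : ∀ i, Derives (knownBits y ∪ knownBits x) (A.pubLen n * 6)
      (knownBits fun z => xorEquiv (sh i) (x z)) := fun i => Derives.iUnion_fin fun j =>
    Derives.oneHot_map (Set.subset_union_of_subset_right (oneHot_bit_subset x j) _)
      fun b => xor b (sh i j)
  have := Derives.exists_of fun i => (hshift i).trans_union (Derives.forall_of fun a =>
    Derives.exists_of fun b => ((hq N y (fun z => xorEquiv (sh i) (x z)) (R a b)).mono_left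
      (Set.union_subset_union_left _ Set.subset_union_left)).not_of)
  simp only [Fintype.card_fin] at this
  exact this

theorem derives_oneHot_bool {α : Type} {F : Set ((α → Bool) → Prop)} {m : ℕ}
    {f : (α → Bool) → Bool} (h : Derives F m {fun x => f x = true}) :
    Derives F (m + 1) (oneHot f) := by
  have := h.trans (Derives.not (P := fun x => f x = true) (Set.mem_singleton _)).keep
  refine this.mono_right ?_
  rintro _ ⟨_ | _, rfl⟩
  · exact Or.inr (by simp)
  · exact Or.inl rfl

theorem derives_getD {α : Type} {m : ℕ} (e : Fin m → α) (i : ℕ) :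
    Derives ∅ 2 (oneHot fun x : α → Bool => (List.ofFn fun j => x (e j)).getD i false) := by
  refine derives_oneHot_bool (m := 1) ?_
  by_cases hi : i < m
  · convert Derives.input (F := ∅) (e ⟨i, hi⟩) using 3 with x
    rw [List.getD_eq_getElem _ _ (by simpa using hi)]
    simp
  · convert Derives.const (α := α) (F := ∅) False using 3 with x
    rw [List.getD_eq_default _ _ (by simpa using hi)]
    simp

/-- The relation of the search problem: on instances of length `P n`, where `n` is hard, the
solutions are the codes of input labelings on which the algorithm fails. -/
def SearchRel (A : LocalAlgorithm Ψ c r) (G : ∀ n : ℕ, Network Ψ.maxDeg c n) (Hard : ℕ → Prop)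
    (P g s M : ℕ → ℕ) (R : ∀ n, Fin (g n) → Fin (s n) → Fin n → Bits (A.privLen n))
    (sh : ∀ n, Fin (M n) → Bits (A.pubLen n)) (x w : List Bool) : Prop :=
  (∃ n, Hard n ∧ P n = x.length ∧ w.length = Fintype.card (Ψ.InputWire n) ∧
    FailsOn A (G n) (R n) (sh n) (fun i => x.getD i false)
      (fun c => w.getD (Fintype.equivFin (Ψ.InputWire n) c) false)) ∨
  -- Instances of all other lengths get the empty string as their solution, which keeps the relation
  -- total.
  ((¬ ∃ n, Hard n ∧ P n = x.length) ∧ w = [])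

theorem polyBounded_card_inputWire (Ψ : LCL) :
    PolyBounded fun n => Fintype.card (Ψ.InputWire n) := by
  have id := PolyBounded.id
  have k := PolyBounded.const
  refine ((id.mul (k (Nat.size Ψ.nodeIn))).add (id.mul (id.mul (k (Nat.size Ψ.halfIn))))).of_le
    fun n => ?_
  simp

/-- The length of the instance determines `n`, because `P` is injective, so the hardness of `n` and
the advice for it are constants of the circuit. Bounds in `n` are bounds in the length since `n ≤ P
n`. -/
theorem searchRel_inTFNPpoly (A : LocalAlgorithm Ψ c r) (G : ∀ n : ℕ, Network Ψ.maxDeg c n)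
    (Hard : ℕ → Prop) (P g s M : ℕ → ℕ)
    (R : ∀ n, Fin (g n) → Fin (s n) → Fin n → Bits (A.privLen n))
    (sh : ∀ n, Fin (M n) → Bits (A.pubLen n)) (hP : StrictMono P) (hg : PolyBounded g)
    (hs : PolyBounded s) (hM : PolyBounded M)
    (htotal : ∀ n, Hard n → ∀ x, ∃ y, FailsOn A (G n) (R n) (sh n) x y) :
    InTFNPpoly (SearchRel A G Hard P g s M R sh) where
  bounded := by
    obtain ⟨p, hp⟩ := polyBounded_card_inputWire Ψ
    refine ⟨p, fun x w h => ?_⟩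
    obtain ⟨n, -, hn, hw, -⟩ | ⟨-, rfl⟩ := h
    · rw [hw, ← hn]
      exact (hp n).trans (eval_mono_nat p (hP.id_le n))
    · simp
  verifiable := by
    obtain ⟨q, hq⟩ := exists_failsOn_cost A
    have hk : PolyBounded A.pubLen := A.pubLen_poly
    have hL := polyBounded_card_inputWire Ψ
    let cost : ℕ → ℕ := fun n =>
      Fintype.card (Ψ.InputWire n) * 2 + A.pubLen n * 2 +
        (M n * (A.pubLen n * 6 + (g n * (s n * (q.eval n + 1) + (s n + 1)) + (g n + 1))) +
          (M n + 1))
    obtain ⟨p, hp⟩ : PolyBounded cost := by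
      have k := PolyBounded.const
      exact ((hL.mul (k _)).add (hk.mul (k _))).add ((hM.mul ((hk.mul (k _)).add
        ((hg.mul ((hs.mul ((PolyBounded.eval q).add (k _))).add (hs.add (k _)))).add
          (hg.add (k _))))).add (hM.add (k _)))
    refine ⟨p + 1, fun l m => ?_⟩
    have hconst : ∀ b : Prop, (∀ (x : Bits l) (w : Bits m), b ↔
        SearchRel A G Hard P g s M R sh (List.ofFn x) (List.ofFn w)) →
        ∃ C : Circuit (Fin l ⊕ Fin m) Unit, C.size ≤ (p + 1).eval (l + m) ∧
          ∀ (x : Bits l) (w : Bits m), C.eval (Sum.elim x w) () = true ↔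
            SearchRel A G Hard P g s M R sh (List.ofFn x) (List.ofFn w) := by
      intro b hb
      obtain ⟨C, hC, hC'⟩ := (Derives.const (α := Fin l ⊕ Fin m) (F := ∅) b).circuit
      exact ⟨C, hC.trans (by simp), fun x w => (hC' _).trans (hb x w)⟩
    by_cases hl : ∃ n, Hard n ∧ P n = l
    · obtain ⟨n, hn, rfl⟩ := hl
      have hrel : ∀ x w : List Bool, x.length = P n →
          (SearchRel A G Hard P g s M R sh x w ↔ w.length = Fintype.card (Ψ.InputWire n) ∧
            FailsOn A (G n) (R n) (sh n) (fun i => x.getD i false)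
              (fun c => w.getD (Fintype.equivFin (Ψ.InputWire n) c) false)) := by
        intro x w hx
        constructor
        · rintro (⟨n', -, hn', h⟩ | ⟨h, -⟩)
          · obtain rfl := hP.injective (hn'.trans hx)
            exact h
          · exact absurd ⟨n, hn, hx.symm⟩ h
        · exact fun h => Or.inl ⟨n, hn, hx.symm, h⟩
      by_cases hm : m = Fintype.card (Ψ.InputWire n)
      · let X : (Fin (P n) ⊕ Fin m → Bool) → Bits (A.pubLen n) := fun z i =>
          (List.ofFn fun j : Fin (P n) => z (Sum.inl j)).getD i false
        let Y : (Fin (P n) ⊕ Fin m → Bool) → Ψ.InputWire n → Bool := fun z c =>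
          (List.ofFn fun j : Fin m => z (Sum.inr j)).getD
            (Fintype.equivFin (Ψ.InputWire n) c) false
        have hY : Derives ∅ (Fintype.card (Ψ.InputWire n) * 2) (knownBits Y) :=
          Derives.iUnion fun c => derives_getD Sum.inr _
        have hX : Derives ∅ (A.pubLen n * 2) (knownBits X) :=
          Derives.iUnion_fin fun i => derives_getD Sum.inl _
        obtain ⟨C, hC, hC'⟩ := ((hY.union hX).trans (hq (G n) (R n) (sh n) X Y)).circuit
        refine ⟨C, hC.trans ?_, fun x w => ?_⟩
        · refine (hp n).trans ((eval_mono_nat p ((hP.id_le n).trans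
            (Nat.le_add_right (P n) m))).trans ?_)
          simp
        · rw [hrel _ _ (by simp), hC']
          simp [X, Y, hm]
      · exact hconst False fun x w => by
          rw [hrel _ _ (by simp), List.length_ofFn]
          simp only [hm, false_and]
    · by_cases hm : m = 0
      · refine hconst True fun x w => iff_of_true trivial (Or.inr ⟨by simpa using hl, ?_⟩)
        subst hm
        simp
      · refine hconst False fun x w => iff_of_false id ?_
        rintro (⟨n, hn, hn', -⟩ | ⟨-, h⟩)
        · exact hl ⟨n, hn, by simpa using hn'⟩
        · exact hm (by simpa using congrArg List.length h)
  total := by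
    intro x
    by_cases hx : ∃ n, Hard n ∧ P n = x.length
    · obtain ⟨n, hn, hn'⟩ := hx
      obtain ⟨y, hy⟩ := htotal n hn fun i => x.getD i false
      refine ⟨List.ofFn fun j => y ((Fintype.equivFin (Ψ.InputWire n)).symm j),
        Or.inl ⟨n, hn, hn', by simp, ?_⟩⟩
      convert hy using 1
      ext c
      rw [List.getD_eq_getElem _ _ (by simp only [List.length_ofFn, Fin.is_lt])]
      simp only [List.getElem_ofFn, Fin.eta, Equiv.symm_apply_apply]
    · exact ⟨[], Or.inr ⟨hx, rfl⟩⟩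

/-- A solver of the search problem yields an adversary. -/
theorem exists_adversary (A : LocalAlgorithm Ψ c r) (G : ∀ n : ℕ, Network Ψ.maxDeg c n)
    (Hard : ℕ → Prop) (P g s M : ℕ → ℕ)
    (R : ∀ n, Fin (g n) → Fin (s n) → Fin n → Bits (A.privLen n))
    (sh : ∀ n, Fin (M n) → Bits (A.pubLen n)) (hP : StrictMono P) {n : ℕ} (hn : Hard n)
    (hk : A.pubLen n ≤ P n) (hM : 0 < M n) {δ : ℝ}
    (hsound : ∀ x y, (∀ a, ∃ b, ¬ A.IsValid (G n) (Ψ.decodeInput y) x (R n a b)) →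
      δ ≤ prob fun rsec => ¬ A.IsValid (G n) (Ψ.decodeInput y) x rsec)
    (htotal : ∀ x, ∃ w, SearchRel A G Hard P g s M R sh x w) (sol : Solver (P n)) :
    ∃ B : BoundedAdversary A n,
      B.circuit.size ≤ 1 + 1 + A.pubLen n * 2 + sol.prog.circuit.size ∧
      winProb (SearchRel A G Hard P g s M R sh) id sol / M n * δ ≤
        1 - boundedSuccess A (G n) B := by
  have hsample : ∀ ρ : Bits (P n), sample id ρ = ρ := by
    intro ρ
    ext i
    simp [sample]
  obtain ⟨B, hB, hB'⟩ := exists_advantage (Fintype.equivFin (Ψ.InputWire n)) hk hM (sh n)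
    (fun x y => ∀ a, ∃ b, ¬ A.IsValid (G n) (Ψ.decodeInput y) x (R n a b)) sol
    (fun ω => (∃ w, SearchRel A G Hard P g s M R sh (List.ofFn (sample id ω.1)) w) →
      SearchRel A G Hard P g s M R sh (List.ofFn (sample id ω.1))
        (sol.run (sample id ω.1) ω.1 ω.2)) (by
      intro ω hω
      -- Totality discharges the premise of the winning condition, so a win is an actual solution.
      replace hω := hω (htotal _)
      rw [hsample] at hω
      obtain ⟨n', hn', hl, hw, hf⟩ | ⟨h, -⟩ := hω
      · obtain rfl : n' = n := hP.injective (hl.trans (by simp))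
        exact ⟨hw, hf⟩
      · exact absurd ⟨n, hn, by simp⟩ h)
  refine ⟨B, hB, ?_⟩
  have hδ : ∀ ω : Bits B.coins × Bits (A.pubLen n),
      (∀ a, ∃ b, ¬ A.IsValid (G n) (Ψ.decodeInput (B.run ω.2 ω.1)) ω.2 (R n a b)) →
      δ ≤ prob fun rsec => ¬ A.IsValid (G n) (Ψ.decodeInput (B.run ω.2 ω.1)) ω.2 rsec :=
    fun ω => hsound _ _
  by_cases h0 : 0 ≤ δ
  · have h1 := mul_le_prob_prod (P := fun ω : (Bits B.coins × Bits (A.pubLen n)) ×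
      (Fin n → Bits (A.privLen n)) =>
        ¬ A.IsValid (G n) (Ψ.decodeInput (B.run ω.1.2 ω.1.1)) ω.1.2 ω.2) hδ
    rw [← prob_equiv (Equiv.prodAssoc _ _ _).symm] at h1
    refine (mul_le_mul_of_nonneg_right hB' h0).trans (h1.trans_eq ?_)
    rw [boundedSuccess, ← prob_not]
    rfl
  · have h1 : boundedSuccess A (G n) B ≤ 1 := prob_le_one _
    have h2 : 0 ≤ winProb (SearchRel A G Hard P g s M R sh) id sol / M n :=
      div_nonneg (prob_nonneg _) (by positivity)
    nlinarith

end Search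

/-! ### Codes of labelings and the uniform sampler -/

theorem decodeLabel_encodeLabel {a : ℕ} (ha : 0 < a) (l : Fin a) :
    decodeLabel ha (encodeLabel l) = l := by
  have h : Nat.ofBits (encodeLabel l) = l := by
    unfold encodeLabel
    rw [Nat.ofBits_testBit, Nat.mod_eq_of_lt]
    exact l.2.trans (Nat.lt_size_self a)
  simp [decodeLabel, h]

/-- Needed so that every answer of an unbounded adversary has a code and can serve as a solution. -/
theorem decodeInput_surjective (Ψ : LCL) (n : ℕ) :
    Function.Surjective (Ψ.decodeInput (n := n)) := fun x =>
  ⟨Sum.elim (fun c => encodeLabel (x.node c.1) c.2) fun c => encodeLabel (x.half c.1 c.2.1) c.2.2, by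
    cases x
    simp [LCL.decodeInput, decodeLabel_encodeLabel]⟩

theorem isSampler_id : IsSampler id fun l => PMF.uniformOfFintype (Bits l) where
  polyTime := ⟨Turing.idComputableInPolyTime id⟩
  length_eq _ := rfl
  law l x := by
    classical
    have : (Finset.univ.filter fun ω : Bits l => id (List.ofFn ω) = List.ofFn x) = {x} := by
      ext ω
      simp [List.ofFn_injective.eq_iff]
    rw [prob_eq, this]
    simp

end PresetCoins

/-! ### Choice of the parameters and conclusion -/

open PresetCoins
theorem theorem3 (Ψ : LCL) (c : ℕ) (r : ℕ → ℕ) (A : LocalAlgorithm Ψ c r)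
    (ε : ℕ → ℝ) (hε_mem : ∀ n, ε n ∈ Set.Icc (0 : ℝ) 1) (hε : Negligible ε)
    (hbounded : SolvesAgainstBounded A ε)
    (H : Set ℕ) (hH : H.Infinite) (G : ∀ n : ℕ, Network Ψ.maxDeg c n)
    (φ : ℕ → ℝ) (hφ_mem : ∀ n, φ n ∈ Set.Icc (0 : ℝ) 1)
    (hφ : ∃ p : Polynomial ℕ, ∀ᶠ n : ℕ in Filter.atTop,
      0 < p.eval n ∧ 1 / ((p.eval n : ℕ) : ℝ) ≤ φ n)
    (hunbounded : ∀ n ∈ H, ∃ B : UnboundedAdversary A n, φ n ≤ unboundedFailure A (G n) B) :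
    ∃ (S : List Bool → List Bool → Prop) (D : ∀ ℓ : ℕ, PMF (Bits ℓ)) (F : List Bool → List Bool),
      InTFNPpoly S ∧ IsSampler F D ∧ PublicCoinIOHard S F := by
  classical
  obtain ⟨p, hp⟩ := hφ
  obtain ⟨pp, hpp⟩ := A.pubLen_poly
  -- The number of bits of a pair (public coins, code of a labeling), over which the union bound for
  -- the samples runs.
  let a : ℕ → ℕ := fun n => A.pubLen n + Fintype.card (Ψ.InputWire n)
  let g : ℕ → ℕ := fun n => a n + 2
  let s : ℕ → ℕ := fun n => (a n + (a n + 2)) * (2 * p.eval n)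
  let M : ℕ → ℕ := fun n => (A.pubLen n + 1) * (2 * p.eval n)
  -- `pp` leaves room for the public coins; `X` makes `P` strictly increasing, so that lengths
  -- determine `n`.
  let P : Polynomial ℕ := pp + Polynomial.X
  have hPeval : ∀ n, P.eval n = pp.eval n + n := by simp [P]
  have hPmono : StrictMono fun n => P.eval n := by
    intro i j hij
    simp only [hPeval]
    exact add_lt_add_of_le_of_lt (eval_mono_nat pp hij.le) hij
  have hk : ∀ n, A.pubLen n ≤ P.eval n := fun n => by
    rw [hPeval]
    exact (hpp n).trans (Nat.le_add_right _ _)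
  let Hard : ℕ → Prop := fun n => n ∈ H ∧ 0 < p.eval n ∧ 1 / ((p.eval n : ℕ) : ℝ) ≤ φ n
  have hadvice : ∀ n, ∃ (R : Fin (g n) → Fin (s n) → Fin n → Bits (A.privLen n))
      (sh : Fin (M n) → Bits (A.pubLen n)), Hard n →
      (∀ x, ∃ y i, ∀ a, ∃ b,
        ¬ A.IsValid (G n) (Ψ.decodeInput y) (xorEquiv (sh i) x) (R a b)) ∧
      ∀ x y, (∀ a, ∃ b, ¬ A.IsValid (G n) (Ψ.decodeInput y) x (R a b)) →
        1 / (2 * (s n : ℝ)) < prob fun rsec => ¬ A.IsValid (G n) (Ψ.decodeInput y) x rsec := by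
    intro n
    by_cases hn : Hard n
    · obtain ⟨hnH, hp0, hpφ⟩ := hn
      obtain ⟨B, hB⟩ := hunbounded n hnH
      choose y hy using fun x => decodeInput_surjective Ψ n (B x)
      obtain ⟨R, sh, h⟩ := exists_advice (a := a n)
        (fun x y rsec => ¬ A.IsValid (G n) (Ψ.decodeInput y) x rsec)
        (by simp [a, pow_add, -Fintype.card_sum]) hp0 y (by simp only [hy]; exact hpφ.trans hB)
      exact ⟨R, sh, fun _ => h⟩
    · exact ⟨fun _ _ _ _ => false, fun _ _ => false, fun h => absurd h hn⟩
  choose R sh hadvice using hadvice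
  have ha : PolyBounded a := PolyBounded.add A.pubLen_poly (polyBounded_card_inputWire Ψ)
  have hg : PolyBounded g := ha.add (.const 2)
  have hs : PolyBounded s := (ha.add (ha.add (.const 2))).mul ((PolyBounded.const 2).mul (.eval p))
  have hM : PolyBounded M :=
    (PolyBounded.add A.pubLen_poly (.const 1)).mul ((PolyBounded.const 2).mul (.eval p))
  have hS := searchRel_inTFNPpoly A G Hard (fun n => P.eval n) g s M R sh hPmono hg hs hM
    fun n hn x => (hadvice n hn).1 x
  refine ⟨_, _, _, hS, isSampler_id, fun T => ?_⟩
  -- The loss of the reduction: a factor `M` for the translate and `2 * s` for the sampled test.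
  obtain ⟨q, hq⟩ := (hM.mul ((PolyBounded.const 2).mul hs))
  let inv := Function.invFun fun n => P.eval n
  have hinv : ∀ n, inv (P.eval n) = n := Function.leftInverse_invFun hPmono.injective
  -- The winning probability is bounded by `q n * ε n` at length `P n`; the summand `(1 / 2) ^ ℓ`
  -- makes the inequality strict even where `ε` vanishes.
  refine ⟨_, ((hε.poly_mul q).reindex P hPmono inv).add negligible_half_pow, fun sol hsol => ?_⟩
  have hadv : ∀ n, ∃ B : BoundedAdversary A n,
      B.circuit.size ≤ (2 + pp * 2 + T.comp P).eval n ∧ (Hard n →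
        winProb (SearchRel A G Hard (fun n => P.eval n) g s M R sh) id (sol (P.eval n)) / M n *
          (1 / (2 * (s n : ℝ))) ≤ 1 - boundedSuccess A (G n) B) := by
    intro n
    by_cases hn : Hard n
    · obtain ⟨B, hB, hB'⟩ := exists_adversary A G Hard (fun n => P.eval n) g s M R sh hPmono hn
        (hk n) (Nat.mul_pos (Nat.succ_pos _) (Nat.mul_pos two_pos hn.2.1))
        (fun x y h => ((hadvice n hn).2 x y h).le) hS.total (sol (P.eval n))
      refine ⟨B, hB.trans ?_, fun _ => hB'⟩
      have h1 := hsol (P.eval n)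
      have h2 := hpp n
      simp only [Polynomial.eval_add, Polynomial.eval_mul, Polynomial.eval_comp,
        Polynomial.eval_ofNat]
      omega
    · exact ⟨⟨0, [], fun _ => 0⟩, by simp [Circuit.size], fun h => absurd h hn⟩
  choose B hBsize hB using hadv
  -- The adversary built for `G n` is used on every `n`-vertex network; only its performance on `G
  -- n` matters.
  have hev := hbounded (2 + pp * 2 + T.comp P) (fun n _ => B n) fun n _ => hBsize n
  have hfreq : ∃ᶠ n in Filter.atTop, n ∈ H := Nat.frequently_atTop_iff_infinite.2 hH
  -- Infinitely many hard `n`, beyond the thresholds of `hp` and `hev`, give infinitely many lengths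
  -- `P n`.
  refine hPmono.tendsto_atTop.frequently ((hfreq.and_eventually (hp.and hev)).mono ?_)
  rintro n ⟨hnH, hn, hsucc⟩
  have hwin := (hB n ⟨hnH, hn⟩).trans (by linarith [hsucc (G n)] : _ ≤ ε n)
  have hMpos : 0 < M n := Nat.mul_pos (Nat.succ_pos _) (Nat.mul_pos two_pos hn.1)
  have hspos : 0 < s n := Nat.mul_pos (by omega) (Nat.mul_pos two_pos hn.1)
  have hMpos' : (0 : ℝ) < M n := by exact_mod_cast hMpos
  have hspos' : (0 : ℝ) < s n := by exact_mod_cast hspos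
  rw [div_mul_div_comm, mul_one, div_le_iff₀ (by positivity)] at hwin
  have hq' : (M n : ℝ) * (2 * s n) ≤ ((q.eval n : ℕ) : ℝ) := by exact_mod_cast hq n
  have hle := mul_le_mul_of_nonneg_left hq' (hε_mem n).1
  have hpos : (0 : ℝ) < (1 / 2) ^ P.eval n := by positivity
  simp only [Pi.add_apply, hinv, if_true]
  linarith
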